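/- **Setting.** Let $\mathsf X$ be a measurable space with a $\sigma$-finite measure $\mathrm dx$. A model consists of a probability density $M_1$ on $\mathsf X$, Markov transition densities $M_t(x,y)$ ($t\ge2$), and measurable potentials $G_1:\mathsf X\to[0,\infty)$, $G_t:\mathsf X^2\to[0,\infty)$ ($t\ge 2$). Its target with horizon $T$ is the probability $\pi_T$ on $\mathsf X^T$ with density proportional to $$\gamma_T(x_{1:T})=M_1(x_1)G_1(x_1)\prod_{t=2}^T M_t(x_{t-1},x_t)\,G_t(x_{t-1},x_t).$$ Write $G_*(t),G^*(t),M_*(t),M^*(t)$ for the infimum and the supremum of $G_t$ and $M_t$ over all their arguments. For $\epsilon>0$, say that the model is *$\epsilon$-strongly mixing up to $T$* if $0<G_*(t)\le G^*(t)<\infty$ for $1\le t\le T$, $0<M_*(t)\le M^*(t)<\infty$ for $2\le t\le T$, and $$\epsilon\le \frac{G_*(t)}{G^*(t)}\quad(1\le t\le T),\qquad \epsilon\le\frac{G_*(t)\,M_*(t+1)\,G_*(t+1)}{G^*(t)\,M^*(t+1)\,G^*(t+1)}\quad(1\le t<T).$$ **Algorithm.** The conditional backward sampling particle filter (CBPF)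 with $N$ particles, given a reference trajectory $x^*_{1:T}$, does the following. Here $\mathrm{Categ}(w^{(1:N)})$ takes the value $i$ with probability $w^{(i)}/\sum_j w^{(j)}$, and all draws are (conditionally) independent. Set $X^{(1)}_t=x^*_t$ for all $t$; draw $X_1^{(i)}\sim M_1$ for $2\le i\le N$ and set $\omega_1^{(i)}=G_1(X_1^{(i)})$ for $1\le i\le N$. For $t=2,\dots,T$: set $I_t^{(1)}=1$; draw $I_t^{(i)}\sim\mathrm{Categ}(\omega_{t-1}^{(1:N)})$ and $X_t^{(i)}\sim M_t(X_{t-1}^{(I_t^{(i)})},\cdot)$ for $2\le i\le N$; set $\omega_t^{(i)}=G_t(X_{t-1}^{(I_t^{(i)})},X_t^{(i)})$ for $1\le i\le N$. Draw $J_T\sim\mathrm{Categ}(\omega_T^{(1:N)})$, and for $t=T-1,\dots,1$ draw $J_t\sim\mathrm{Categ}(b_t^{(1:N)})$ with $b_t^{(i)}=\omega_t^{(i)}M_{t+1}(X_t^{(i)},X_{t+1}^{(J_{t+1})})\,G_{t+1}(X_t^{(i)},X_{t+1}^{(J_{t+1})})$. Output $(X_1^{(J_1)},\dots,X_T^{(J_T)})$.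 Let $P_{T,N}$ be the resulting Markov transition probability on $\mathsf X^T$, $P_{T,N}^k$ its $k$-th iterate, and $\|\mu-\nu\|_{\mathrm{tv}}=\sup_{|f|\le1}|\mu(f)-\nu(f)|$, the supremum being over measurable $f$. **Theorem.** Let $\epsilon>0$. 1. For every $\rho>0$ there is $N_0=N_0(\epsilon,\rho)<\infty$ such that for all $N\ge N_0$: if for every $T\ge1$ the model with horizon $T$ is $\epsilon$-strongly mixing up to $T$ (the same $\epsilon$ for all $T$; the model, on a fixed $\mathsf X$, may vary with $T$, in particular it may be one fixed infinite sequence $(M_t,G_t)_{t\ge1}$), then $$\lim_{T\to\infty}\ \sup_{x\in\mathsf X^T}\big\|P_{T,N}^{\lceil\rho T\rceil}(x,\cdot)-\pi_T\big\|_{\mathrm{tv}}=0.\qquad(*)$$ 2. More precisely, for all $\alpha,\beta\in(1,\infty)$ there is $N_0=N_0(\epsilon,\alpha,\beta)\in\mathbb N$ such that for all $N\ge N_0$: (i) for every $T\ge1$, every model that is $\epsilon$-strongly mixing up to $T$, and every $k\ge1$, $$\sup_{x\in\mathsf X^T}\big\|P_{T,N}^k(x,\cdot)-\pi_T\big\|_{\mathrm{tv}}\le\alpha^T\beta^{-k};$$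 (ii) for every $\rho>\log\alpha/\log\beta$, $(*)$ holds under the assumption stated in 1. The numbers $N_0$ depend only on the quantities indicated, not on the space, the model or $T$. -/

import Mathlib

open MeasureTheory ProbabilityTheory Filter Topology
open scoped ENNReal NNReal

noncomputable section

namespace ParticleFilter

/-! ### Total variation -/

/-- The total variation distance `‖ν₁ - ν₂‖_tv = sup_{|f| ≤ 1} |ν₁(f) - ν₂(f)|`, the supremum being
over measurable `f`. Between probability measures it takes values in `[0, 2]`. -/
def tvDist {E : Type*} [MeasurableSpace E] (ν₁ ν₂ : Measure E) : ℝ≥0∞ :=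
  ⨆ f : {f : E → ℝ // Measurable f ∧ ∀ x, |f x| ≤ 1},
    ENNReal.ofReal |(∫ x, f.1 x ∂ν₁) - ∫ x, f.1 x ∂ν₂|

/-! ### Independent coordinates -/

/-- The kernel under which, given `a`, the coordinates are independent and the `i`-th one has
law `κ i a`. -/
def piKernel {A E : Type*} [MeasurableSpace A] [MeasurableSpace E] {N : ℕ}
    (κ : Fin N → Kernel A E) [∀ i, IsFiniteKernel (κ i)] : Kernel A (Fin N → E) where
  toFun a := Measure.pi fun i => κ i a
  measurable' := by
    refine Measurable.measure_of_isPiSystem generateFrom_pi.symm isPiSystem_pi ?_ ?_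
    · rintro _ ⟨s, hs, rfl⟩
      simp only [Measure.pi_pi]
      exact Finset.measurable_prod _ fun i _ => (κ i).measurable_coe (hs i (Set.mem_univ i))
    · simp only [Measure.pi_univ]
      exact Finset.measurable_prod _ fun i _ => (κ i).measurable_coe MeasurableSet.univ

instance {A E : Type*} [MeasurableSpace A] [MeasurableSpace E] {N : ℕ}
    (κ : Fin N → Kernel A E) [∀ i, IsMarkovKernel (κ i)] : IsMarkovKernel (piKernel κ) :=
  ⟨fun a => by
    change IsProbabilityMeasure (Measure.pi fun i => κ i a)
    infer_instance⟩

instance {A E : Type*} [MeasurableSpace A] [MeasurableSpace E] {N : ℕ}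
    (κ : Fin N → Kernel A E) [∀ i, IsFiniteKernel (κ i)] : IsFiniteKernel (piKernel κ) :=
  ⟨⟨∏ i, (κ i).bound, ENNReal.prod_lt_top fun i _ => (κ i).bound_lt_top, fun a => by
    change (Measure.pi fun i => κ i a) Set.univ ≤ _
    rw [Measure.pi_univ]
    exact Finset.prod_le_prod' fun i _ => (κ i).measure_le_bound a Set.univ⟩⟩

/-! ### Categorical sampling -/

/-- `Categ(w)` for unnormalised weights `w`: the index `i` has probability `w i / ∑ j, w j`
(the zero measure when all the weights vanish). -/
def categ {N : ℕ} (w : Fin N → ℝ≥0) : Measure (Fin N) :=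
  ∑ i, ((w i : ℝ≥0∞) / ∑ j, (w j : ℝ≥0∞)) • Measure.dirac i

lemma categ_univ_le {N : ℕ} (w : Fin N → ℝ≥0) : categ w Set.univ ≤ 1 := by
  simp only [categ, Measure.coe_finsetSum, Finset.sum_apply, Measure.smul_apply, measure_univ,
    smul_eq_mul, mul_one]
  simp only [div_eq_mul_inv, ← Finset.sum_mul]
  exact ENNReal.mul_inv_le_one _

/-- A generation of `N` particles, each with its unnormalised weight. -/
abbrev Generation (N : ℕ) (X : Type*) := Fin N → X × ℝ≥0

/-- The law of `X^(I)` for `I ∼ Categ(ω^(1:N))`, given the generation `(X^(i), ω^(i))`. -/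
def select (N : ℕ) (X : Type*) [MeasurableSpace X] : Kernel (Generation N X) X where
  toFun g := (categ fun i => (g i).2).map fun i => (g i).1
  measurable' := by
    refine Measure.measurable_of_measurable_coe _ fun s hs => ?_
    have h : ∀ g : Generation N X, ((categ fun i => (g i).2).map fun i => (g i).1) s =
        ∑ i, (((g i).2 : ℝ≥0∞) / ∑ j, ((g j).2 : ℝ≥0∞)) *
          s.indicator (1 : X → ℝ≥0∞) (g i).1 := by
      intro g
      rw [Measure.map_apply (measurable_of_finite _) hs]
      simp only [categ, Measure.coe_finsetSum, Finset.sum_apply, Measure.smul_apply, smul_eq_mul]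
      refine Finset.sum_congr rfl fun i _ => ?_
      rw [Measure.dirac_apply' _ (measurable_of_finite (fun i => (g i).1) hs)]
      rfl
    simp only [h]
    refine Finset.measurable_sum _ fun i _ => Measurable.mul (Measurable.div ?_ ?_) ?_
    · fun_prop
    · exact Finset.measurable_sum _ fun j _ => by fun_prop
    · exact (measurable_one.indicator hs).comp (by fun_prop)

instance (N : ℕ) (X : Type*) [MeasurableSpace X] : IsFiniteKernel (select N X) :=
  ⟨⟨1, ENNReal.one_lt_top, fun g => by
    change ((categ fun i => (g i).2).map fun i => (g i).1) Set.univ ≤ 1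
    rw [Measure.map_apply (measurable_of_finite _) MeasurableSet.univ]
    exact categ_univ_le _⟩⟩

/-! ### The model -/

/-- The model `(M_t, G_t)_{t ≥ 1}` on the state space `X` with dominating measure `μ`: an initial
probability density `M₁`, Markov transition densities `M t x y` from time `t - 1` to time `t`,
and potentials `G₁ x` and `G t x y`. The members `M t` and `G t` are used for `t ≥ 2` only, and for
`t ≤ T` only when the horizon is `T`. -/
structure Model (X : Type*) [MeasurableSpace X] (μ : Measure X) where
  M₁ : X → ℝ≥0
  M : ℕ → X → X → ℝ≥0
  G₁ : X → ℝ≥0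
  G : ℕ → X → X → ℝ≥0
  measurable_M₁ : Measurable M₁
  measurable_M : ∀ t, Measurable fun p : X × X => M t p.1 p.2
  measurable_G₁ : Measurable G₁
  measurable_G : ∀ t, Measurable fun p : X × X => G t p.1 p.2
  lintegral_M₁ : ∫⁻ x, (M₁ x : ℝ≥0∞) ∂μ = 1
  lintegral_M : ∀ t x, ∫⁻ y, (M t x y : ℝ≥0∞) ∂μ = 1

namespace Model

variable {X : Type*} [MeasurableSpace X] {μ : Measure X}

/-- The unnormalised density
`γ_T(x_{1:T}) = M₁(x₁) G₁(x₁) ∏_{t=2}^T M_t(x_{t-1}, x_t) G_t(x_{t-1}, x_t)` on `X^T`.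
The coordinates of `x : Fin T → X` are numbered from `0`. -/
def gamma (𝓜 : Model X μ) : (T : ℕ) → (Fin T → X) → ℝ≥0
  | 0, _ => 1
  | n + 1, x => 𝓜.M₁ (x 0) * 𝓜.G₁ (x 0) *
      ∏ i : Fin n, 𝓜.M (i + 2) (x i.castSucc) (x i.succ) * 𝓜.G (i + 2) (x i.castSucc) (x i.succ)

/-- The normalising constant `c_T = ∫ γ_T(x_{1:T}) dx_{1:T}`. -/
def normConst [SigmaFinite μ] (𝓜 : Model X μ) (T : ℕ) : ℝ≥0∞ :=
  ∫⁻ x, (𝓜.gamma T x : ℝ≥0∞) ∂(Measure.pi fun _ : Fin T => μ)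

/-- The target `π_T`, with density `γ_T / c_T` with respect to the product measure on `X^T`. -/
def target [SigmaFinite μ] (𝓜 : Model X μ) (T : ℕ) : Measure (Fin T → X) :=
  (Measure.pi fun _ : Fin T => μ).withDensity fun x => (𝓜.gamma T x : ℝ≥0∞) / 𝓜.normConst T

/-! ### Strong mixing -/

/-- `G_*(t)`: the infimum of the potential at time `t ≥ 1`. -/
def Glow (𝓜 : Model X μ) (t : ℕ) : ℝ≥0 :=
  if t = 1 then ⨅ x, 𝓜.G₁ x else ⨅ p : X × X, 𝓜.G t p.1 p.2

/-- `G^*(t)`: the supremum of the potential at time `t ≥ 1` (meaningful when it is bounded). -/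
def Gup (𝓜 : Model X μ) (t : ℕ) : ℝ≥0 :=
  if t = 1 then ⨆ x, 𝓜.G₁ x else ⨆ p : X × X, 𝓜.G t p.1 p.2

/-- `M_*(t)`, for `t ≥ 2`. -/
def Mlow (𝓜 : Model X μ) (t : ℕ) : ℝ≥0 := ⨅ p : X × X, 𝓜.M t p.1 p.2

/-- `M^*(t)`, for `t ≥ 2` (meaningful when `M t` is bounded). -/
def Mup (𝓜 : Model X μ) (t : ℕ) : ℝ≥0 := ⨆ p : X × X, 𝓜.M t p.1 p.2

/-- Strong mixing up to the horizon `T`, with mixing constant at least `ε`: potentials and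
transition densities are bounded, and bounded away from zero, and `ε` is a lower bound of
`δ = min_{1 ≤ t ≤ T} G_*(t) / G^*(t)` and of
`min_{1 ≤ t < T} G_*(t) M_*(t+1) G_*(t+1) / (G^*(t) M^*(t+1) G^*(t+1))`.
For `T ≥ 2` the bound on `δ` follows from the other one. -/
structure StrongMixing (𝓜 : Model X μ) (T : ℕ) (ε : ℝ≥0) : Prop where
  bddAbove_G₁ : BddAbove (Set.range 𝓜.G₁)
  bddAbove_G : ∀ t, 2 ≤ t → t ≤ T → BddAbove (Set.range fun p : X × X => 𝓜.G t p.1 p.2)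
  Glow_pos : ∀ t, 1 ≤ t → t ≤ T → 0 < 𝓜.Glow t
  bddAbove_M : ∀ t, 2 ≤ t → t ≤ T → BddAbove (Set.range fun p : X × X => 𝓜.M t p.1 p.2)
  Mlow_pos : ∀ t, 2 ≤ t → t ≤ T → 0 < 𝓜.Mlow t
  le_delta : ∀ t, 1 ≤ t → t ≤ T → ε ≤ 𝓜.Glow t / 𝓜.Gup t
  le_epsilon : ∀ t, 1 ≤ t → t < T →
    ε ≤ (𝓜.Glow t * 𝓜.Mlow (t + 1) * 𝓜.Glow (t + 1)) /
      (𝓜.Gup t * 𝓜.Mup (t + 1) * 𝓜.Gup (t + 1))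

/-! ### The conditional backward sampling particle filter

The particle with index `0 : Fin N` carries the reference trajectory. -/

/-- The law `M₁(x) dx`. -/
def initLaw (𝓜 : Model X μ) : Measure X := μ.withDensity fun x => (𝓜.M₁ x : ℝ≥0∞)

instance (𝓜 : Model X μ) : IsProbabilityMeasure 𝓜.initLaw :=
  ⟨by rw [initLaw, withDensity_apply _ MeasurableSet.univ, Measure.restrict_univ,
    𝓜.lintegral_M₁]⟩

/-- The Markov kernel `M_t(x, y) dy`. -/
def trans [SigmaFinite μ] (𝓜 : Model X μ) (t : ℕ) : Kernel X X :=
  Kernel.withDensity (Kernel.const X μ) fun x y => (𝓜.M t x y : ℝ≥0∞)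

instance [SigmaFinite μ] (𝓜 : Model X μ) (t : ℕ) : IsMarkovKernel (𝓜.trans t) :=
  ⟨fun x => ⟨by
    have h : Measurable (Function.uncurry fun x y => (𝓜.M t x y : ℝ≥0∞)) :=
      (𝓜.measurable_M t).coe_nnreal_ennreal
    rw [trans, Kernel.withDensity_apply' _ h, Kernel.const_apply, Measure.restrict_univ,
      𝓜.lintegral_M t x]⟩⟩

/-- Attaching the weight `ω₁ = G₁(x)` to a particle at time `1`. -/
def weigh₁ (𝓜 : Model X μ) (x : X) : X × ℝ≥0 := (x, 𝓜.G₁ x)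

/-- Attaching the weight `ω_t = G_t(x, y)` to a particle `y` at time `t` with parent `x`. -/
def weigh (𝓜 : Model X μ) (t : ℕ) (p : X × X) : X × ℝ≥0 := (p.2, 𝓜.G t p.1 p.2)

lemma measurable_weigh₁ (𝓜 : Model X μ) : Measurable 𝓜.weigh₁ :=
  measurable_id.prodMk 𝓜.measurable_G₁

lemma measurable_weigh (𝓜 : Model X μ) (t : ℕ) : Measurable (𝓜.weigh t) :=
  measurable_snd.prodMk (𝓜.measurable_G t)

/-- The weighted `i`-th particle at time `1`, given the reference state at time `1`. -/
def initParticle (𝓜 : Model X μ) {N : ℕ} (i : Fin N) : Kernel X (X × ℝ≥0) :=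
  if (i : ℕ) = 0 then Kernel.deterministic 𝓜.weigh₁ 𝓜.measurable_weigh₁
  else (Kernel.const X 𝓜.initLaw).map 𝓜.weigh₁

instance (𝓜 : Model X μ) {N : ℕ} (i : Fin N) : IsMarkovKernel (𝓜.initParticle i) := by
  unfold initParticle
  split_ifs
  · infer_instance
  · exact Kernel.IsMarkovKernel.map _ 𝓜.measurable_weigh₁

/-- The first generation, given the reference state at time `1`. -/
def initGeneration (𝓜 : Model X μ) (N : ℕ) : Kernel X (Generation N X) :=
  piKernel fun i : Fin N => 𝓜.initParticle i

instance (𝓜 : Model X μ) (N : ℕ) : IsMarkovKernel (𝓜.initGeneration N) := by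
  unfold initGeneration
  infer_instance

/-- The weighted `i`-th particle at time `t ≥ 2`, given the generation at time `t - 1` and the
reference state `x*` at time `t`. The reference particle moves to `x*`, its parent being the
reference particle at time `t - 1`; any other particle samples its parent from `Categ(ω_{t-1})` and
then its state from `M_t(parent, ·)`. -/
def nextParticle [SigmaFinite μ] (𝓜 : Model X μ) {N : ℕ} (t : ℕ) (i : Fin N) :
    Kernel (Generation N X × X) (X × ℝ≥0) :=
  if (i : ℕ) = 0 then
    Kernel.deterministic (fun a : Generation N X × X => 𝓜.weigh t ((a.1 i).1, a.2))
      ((𝓜.measurable_weigh t).comp (by fun_prop))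
  else (((Kernel.id ×ₖ 𝓜.trans t) ∘ₖ select N X).map (𝓜.weigh t)).comap Prod.fst measurable_fst

instance [SigmaFinite μ] (𝓜 : Model X μ) {N : ℕ} (t : ℕ) (i : Fin N) :
    IsFiniteKernel (𝓜.nextParticle t i) := by
  unfold nextParticle
  split_ifs <;> infer_instance

/-- The generation at time `t ≥ 2`, given the one at time `t - 1` and the reference state at
time `t`. -/
def nextGeneration [SigmaFinite μ] (𝓜 : Model X μ) (N t : ℕ) :
    Kernel (Generation N X × X) (Generation N X) :=
  piKernel fun i : Fin N => 𝓜.nextParticle t i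

instance [SigmaFinite μ] (𝓜 : Model X μ) (N t : ℕ) : IsFiniteKernel (𝓜.nextGeneration N t) := by
  unfold nextGeneration
  infer_instance

/-- Replacing the weights of the generation at time `t` by the backward sampling weights
`b_t^(i) = ω_t^(i) M_{t+1}(X_t^(i), y) G_{t+1}(X_t^(i), y)`, where `y` is the state
selected at time `t + 1`. -/
def backwardWeigh (𝓜 : Model X μ) {N : ℕ} (t : ℕ) (a : Generation N X × X) : Generation N X :=
  fun i => ((a.1 i).1, (a.1 i).2 * 𝓜.M (t + 1) (a.1 i).1 a.2 * 𝓜.G (t + 1) (a.1 i).1 a.2)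

lemma measurable_backwardWeigh (𝓜 : Model X μ) {N : ℕ} (t : ℕ) :
    Measurable (𝓜.backwardWeigh (N := N) t) := by
  refine measurable_pi_lambda _ fun i => ?_
  have h : Measurable fun a : Generation N X × X => ((a.1 i).1, a.2) := by fun_prop
  exact Measurable.prodMk (by fun_prop) (((by fun_prop : Measurable fun a : Generation N X × X =>
    (a.1 i).2).mul ((𝓜.measurable_M (t + 1)).comp h)).mul ((𝓜.measurable_G (t + 1)).comp h))

/-- The backward sampling step: the law of `X_t^(J_t)`, with `J_t ∼ Categ(b_t)`, given the generation
at time `t` and the state selected at time `t + 1`. -/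
def backward (𝓜 : Model X μ) (N t : ℕ) : Kernel (Generation N X × X) X :=
  (select N X).comap (𝓜.backwardWeigh t) (𝓜.measurable_backwardWeigh t)

instance (𝓜 : Model X μ) (N t : ℕ) : IsFiniteKernel (𝓜.backward N t) := by
  unfold backward
  infer_instance

lemma _root_.ParticleFilter.measurable_finCons {n : ℕ} :
    Measurable fun p : (Fin n → X) × X => (Fin.cons p.2 p.1 : Fin (n + 1) → X) := by
  refine measurable_pi_lambda _ fun i => ?_
  refine Fin.cases ?_ (fun j => ?_) i
  · simpa using measurable_snd
  · simp only [Fin.cons_succ]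
    fun_prop

/-- The algorithm from time `t` on, when `n` more time steps remain (the horizon is `t + n`): given the
generation at time `t` and the reference trajectory at the times `t + 1, …, t + n`, the law of the
output `(X_t^(J_t), …, X_{t+n}^(J_{t+n}))`. If `n = 0`, then `J_t ∼ Categ(ω_t)`. Otherwise the
generation at time `t + 1` is simulated, the algorithm runs from time `t + 1` on, and finally `J_t` is
drawn by backward sampling, given the generation at time `t` and the state selected at
time `t + 1`. -/
def run [SigmaFinite μ] (𝓜 : Model X μ) (N : ℕ) :
    (n t : ℕ) → Kernel (Generation N X × (Fin n → X)) (Fin (n + 1) → X)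
  | 0, _ => ((select N X).map fun x => fun _ => x).comap Prod.fst measurable_fst
  | n + 1, t =>
    let next : Kernel (Generation N X × (Fin (n + 1) → X)) (Generation N X × (Fin n → X)) :=
      (𝓜.nextGeneration N (t + 1)).comap (fun a => (a.1, a.2 0)) (by fun_prop) ×ₖ
        Kernel.deterministic (fun a i => a.2 i.succ) (by fun_prop)
    let future : Kernel (Generation N X × (Fin (n + 1) → X)) (Fin (n + 1) → X) :=
      run 𝓜 N n (t + 1) ∘ₖ next
    let back : Kernel ((Generation N X × (Fin (n + 1) → X)) × (Fin (n + 1) → X)) X :=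
      (𝓜.backward N t).comap (fun p => (p.1.1, p.2 0)) (by fun_prop)
    (future ⊗ₖ back).map fun p => Fin.cons p.2 p.1

instance [SigmaFinite μ] (𝓜 : Model X μ) (N n t : ℕ) : IsFiniteKernel (𝓜.run N n t) := by
  induction n generalizing t with
  | zero => unfold run; infer_instance
  | succ n ih => unfold run; infer_instance

/-- The transition probability `P_{T,N}` on `X^T` of the conditional backward sampling particle
filter with `N` particles. -/
def cbpf [SigmaFinite μ] (𝓜 : Model X μ) (N : ℕ) : (T : ℕ) → Kernel (Fin T → X) (Fin T → X)
  | 0 => Kernel.id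
  | n + 1 => 𝓜.run N n 1 ∘ₖ
      ((𝓜.initGeneration N).comap (fun x => x 0) (by fun_prop) ×ₖ
        Kernel.deterministic (fun x i => x i.succ) (by fun_prop))

instance [SigmaFinite μ] (𝓜 : Model X μ) (N T : ℕ) : IsFiniteKernel (𝓜.cbpf N T) := by
  cases T with
  | zero => unfold cbpf; infer_instance
  | succ n => unfold cbpf; infer_instance

end Model

end ParticleFilter

end

open ParticleFilter

universe u

/-! Convergence is measured through the action of the kernel `P` on functions. Fix `a < 1` and let
`f` have oscillation at most `w a ^ i` in coordinate `i`. By `cbpf_le`, `P f` has oscillation at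
most `η w a ^ i`, where `η` is `contractionFactor`; this can be made as small as desired by taking
many particles, uniformly in the horizon and the model. A function with values in `[0, 1]` qualifies
with `w = a⁻¹ ^ T`, so after `k` iterations its total oscillation is at most `η ^ k a⁻¹ ^ T / (1 -
a)`. Invariance of the target turns this into a total variation bound (`tvDist_cbpf_pow_le`). Taking
`a⁻¹ ≤ α` and `η` small compared with `β⁻¹` gives `α ^ T β ^ (-k)`.

Why `η` is small: a changed reference state enters the algorithm through a single particle, so the
question is how much one particle influences the output. Integrating out the backward sampling step
at time `t` leaves a function of the later states. The state at time `t + 1` acts on it directly,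
with strength `w a`, and through the backward weights. By strong mixing two backward laws drawn from
the same generation share mass `ε`, so the second effect is at most `(1 - ε) K w`, where `K w`
bounds the oscillation in the first coordinate. If `a + (1 - ε) K ≤ K a`, the new function is of the
same type with `w` replaced by `w a` (`tame_integrateBackward`): influence is discounted by `a` per
time step.

One changed particle alters the backward selection with probability at most `1 / (ε N)`, and the
particles of the next generation with total probability at most `1 + 1 / ε`. Since `(1 + 1 / ε) a`
may exceed one, this recursion is useless over the whole horizon. It is therefore run only to a
fixed depth `d` (`truncatedRun_le`), while everything deeper costs `O(a ^ d)` by the discount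
(`run_le_truncatedRun`). First `d`, then `N`, is chosen large (`exists_contractionFactor_le`).

Invariance rests on exchangeability. A reference drawn from the target is, at each time, a particle
biased by its weight among otherwise i.i.d. particles; averaging over the label it carries
(`lintegral_sizeBiased`) and cancelling the backward normalisation give `sum_lintegral_run` by
induction on the remaining time. -/

namespace ParticleFilter

/-! ### Weighted averages and product measures -/

/-- Two weighted averages with a common part of mass at least `1 - δ`. -/
lemma sum_mul_le_of_overlap {ι : Type*} [Fintype ι] {p p' u φ φ' : ι → ℝ≥0∞} {c δ : ℝ≥0∞}
    (hp : ∑ i, p i = 1) (hp' : ∑ i, p' i = 1) (hu : ∀ i, u i ≤ p i) (hu' : ∀ i, u i ≤ p' i)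
    (hδ : 1 ≤ ∑ i, u i + δ) (hφ : ∀ i, u i * φ i ≤ u i * φ' i) (hc : ∀ i j, φ i ≤ φ' j + c) :
    ∑ i, p i * φ i ≤ ∑ i, p' i * φ' i + δ * c := by
  have hsu : ∑ i, u i ≤ 1 := hp ▸ Finset.sum_le_sum fun i _ => hu i
  have hsu' : ∑ i, u i ≠ ∞ := (hsu.trans_lt ENNReal.one_lt_top).ne
  have hd : ∑ i, u i + ∑ i, (p i - u i) = 1 := by
    rw [← Finset.sum_add_distrib, ← hp]
    exact Finset.sum_congr rfl fun i _ => add_tsub_cancel_of_le (hu i)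
  have hd' : ∑ i, u i + ∑ i, (p' i - u i) = 1 := by
    rw [← Finset.sum_add_distrib, ← hp']
    exact Finset.sum_congr rfl fun i _ => add_tsub_cancel_of_le (hu' i)
  have hD : ∑ i, (p i - u i) = ∑ i, (p' i - u i) :=
    (ENNReal.add_right_inj hsu').1 (hd.trans hd'.symm)
  have hDδ : ∑ i, (p i - u i) ≤ δ := by
    rw [← hd] at hδ
    exact (ENNReal.add_le_add_iff_left hsu').1 hδ
  -- Off the common part `u` both averages carry the same mass, at most `δ`. Comparing every `φ i`
  -- with the smallest `φ' j` costs `c` on that mass only.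
  have key : ∑ i, (p i - u i) * φ i ≤ ∑ i, (p' i - u i) * φ' i + δ * c := by
    have : Nonempty ι := by
      by_contra h
      rw [not_nonempty_iff] at h
      simp at hp
    obtain ⟨j, hj⟩ := Finite.exists_min φ'
    calc ∑ i, (p i - u i) * φ i ≤ ∑ i, (p i - u i) * (φ' j + c) :=
          Finset.sum_le_sum fun i _ => by gcongr; exact hc i j
      _ = (∑ i, (p' i - u i)) * φ' j + (∑ i, (p i - u i)) * c := by
          rw [← Finset.sum_mul, mul_add, hD]
      _ ≤ _ := by
          rw [Finset.sum_mul]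
          gcongr with i
          exact hj i
  calc ∑ i, p i * φ i = ∑ i, u i * φ i + ∑ i, (p i - u i) * φ i := by
        rw [← Finset.sum_add_distrib]
        exact Finset.sum_congr rfl fun i _ => by rw [← add_mul, add_tsub_cancel_of_le (hu i)]
    _ ≤ ∑ i, u i * φ' i + (∑ i, (p' i - u i) * φ' i + δ * c) :=
        add_le_add (Finset.sum_le_sum fun i _ => hφ i) key
    _ = _ := by
        rw [← add_assoc, ← Finset.sum_add_distrib]
        congr 1
        exact Finset.sum_congr rfl fun i _ => by rw [← add_mul, add_tsub_cancel_of_le (hu' i)]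

/-- Averaging over `a` and `b` independently charges `c` exactly once, however far apart the two
laws are. -/
lemma lintegral_le_add_of_osc {E : Type*} [MeasurableSpace E] (p q : Measure E)
    [IsProbabilityMeasure p] [IsProbabilityMeasure q] {φ φ' : E → ℝ≥0∞} {c : ℝ≥0∞}
    (h : ∀ a b, φ a ≤ φ' b + c) : ∫⁻ a, φ a ∂p ≤ ∫⁻ a, φ' a ∂q + c := by
  have h1 : ∀ b, ∫⁻ a, φ a ∂p ≤ φ' b + c := fun b =>
    (lintegral_mono fun a => h a b).trans (by simp)
  calc ∫⁻ a, φ a ∂p = ∫⁻ _, (∫⁻ a, φ a ∂p) ∂q := by simp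
    _ ≤ ∫⁻ b, (φ' b + c) ∂q := lintegral_mono h1
    _ = _ := by rw [lintegral_add_right _ measurable_const]; simp

lemma lintegral_le_add_of_le {E : Type*} [MeasurableSpace E] (p : Measure E)
    (hp : p Set.univ ≤ 1) {φ φ' : E → ℝ≥0∞} {c : ℝ≥0∞}
    (h : ∀ᵐ a ∂p, φ a ≤ φ' a + c) : ∫⁻ a, φ a ∂p ≤ ∫⁻ a, φ' a ∂p + c :=
  calc ∫⁻ a, φ a ∂p ≤ ∫⁻ a, (φ' a + c) ∂p := lintegral_mono_ae h
    _ = ∫⁻ a, φ' a ∂p + c * p Set.univ := by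
        rw [lintegral_add_right _ measurable_const, lintegral_const]
    _ ≤ _ := by gcongr; exact mul_le_of_le_one_right' hp

/-- A one-sided total variation bound: `p φ ≤ q φ + δ c` whenever `φ` has oscillation at most `c`. -/
def OscClose {E : Type*} [MeasurableSpace E] (p q : Measure E) (δ : ℝ≥0∞) : Prop :=
  ∀ (φ : E → ℝ≥0∞) (c : ℝ≥0∞), Measurable φ → (∀ a b, φ a ≤ φ b + c) →
    ∫⁻ a, φ a ∂p ≤ ∫⁻ a, φ a ∂q + δ * c

lemma oscClose_one {E : Type*} [MeasurableSpace E] (p q : Measure E)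
    [IsProbabilityMeasure p] [IsProbabilityMeasure q] : OscClose p q 1 := fun φ c _ h => by
  rw [one_mul]; exact lintegral_le_add_of_osc p q h

lemma oscClose_self {E : Type*} [MeasurableSpace E] (p : Measure E) : OscClose p p 0 :=
  fun φ c _ _ => by simp

lemma measurable_cons {E : Type*} [MeasurableSpace E] {n : ℕ} :
    Measurable fun p : E × (Fin n → E) => (Fin.cons p.1 p.2 : Fin (n + 1) → E) :=
  measurable_finCons.comp measurable_swap

lemma lintegral_pi_cons {E : Type*} [MeasurableSpace E] {n : ℕ} (p : Fin (n + 1) → Measure E)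
    [∀ i, SigmaFinite (p i)] {F : (Fin (n + 1) → E) → ℝ≥0∞} (hF : Measurable F) :
    ∫⁻ g, F g ∂Measure.pi p =
      ∫⁻ a, ∫⁻ g, F (Fin.cons a g) ∂(Measure.pi fun i : Fin n => p i.succ) ∂p 0 := by
  have h := (measurePreserving_piFinSuccAbove p 0).symm
  have he : ∀ z : E × (Fin n → E),
      (MeasurableEquiv.piFinSuccAbove (fun _ : Fin (n + 1) => E) 0).symm z = Fin.cons z.1 z.2 :=
    fun z => Fin.insertNth_zero (α := fun _ : Fin (n + 1) => E) z.1 z.2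
  rw [← h.lintegral_comp hF]
  simp only [he, Fin.succAbove_zero]
  exact lintegral_prod (fun z : E × (Fin n → E) => F (Fin.cons z.1 z.2))
    (hF.comp measurable_cons).aemeasurable

/-- Replacing the factors of a product measure one by one. -/
lemma lintegral_pi_le {E : Type*} [MeasurableSpace E] {n : ℕ} (p q : Fin n → Measure E)
    [∀ i, IsProbabilityMeasure (p i)] [∀ i, IsProbabilityMeasure (q i)] (δ : Fin n → ℝ≥0∞)
    (hpq : ∀ i, OscClose (p i) (q i) (δ i)) {F : (Fin n → E) → ℝ≥0∞} (hF : Measurable F)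
    {L : ℝ≥0∞} (hL : ∀ i g g', (∀ j, j ≠ i → g j = g' j) → F g ≤ F g' + L) :
    ∫⁻ g, F g ∂Measure.pi p ≤ ∫⁻ g, F g ∂Measure.pi q + (∑ i, δ i) * L := by
  induction n with
  | zero => simp [Measure.pi_of_empty p, Measure.pi_of_empty q]
  | succ n ih =>
    rw [lintegral_pi_cons p hF, lintegral_pi_cons q hF, Fin.sum_univ_succ, add_mul]
    have hm : Measurable fun a => ∫⁻ g, F (Fin.cons a g) ∂(Measure.pi fun i : Fin n => q i.succ) :=
      (hF.comp measurable_cons).lintegral_prod_right'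
    -- The tail factors are exchanged with the first coordinate frozen. The integral over the new
    -- tail still has oscillation `L` in the first coordinate, so the first factor can be exchanged
    -- last.
    calc ∫⁻ a, ∫⁻ g, F (Fin.cons a g) ∂(Measure.pi fun i : Fin n => p i.succ) ∂p 0
        ≤ ∫⁻ a, ∫⁻ g, F (Fin.cons a g) ∂(Measure.pi fun i : Fin n => q i.succ) ∂p 0 +
            (∑ i : Fin n, δ i.succ) * L := by
          refine lintegral_le_add_of_le _ (by simp) (ae_of_all _ fun a => ?_)
          refine ih _ _ _ (fun i => hpq i.succ)
            (hF.comp (measurable_cons.comp (measurable_const.prodMk measurable_id))) ?_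
          intro i g g' hg
          refine hL i.succ _ _ fun j => ?_
          refine Fin.cases (fun _ => by simp) (fun j hj => ?_) j
          simpa using hg j (fun h => hj (by rw [h]))
      _ ≤ _ := by
          rw [← add_assoc]
          gcongr
          refine hpq 0 _ L hm fun a b => ?_
          refine lintegral_le_add_of_le _ (by simp) (ae_of_all _ fun g => hL 0 _ _ fun j => ?_)
          refine Fin.cases (fun h => absurd rfl h) (fun j _ => by simp) j

/-- A function with oscillation `c i` in the coordinate `i` has oscillation at most `∑ c i`. -/
lemma le_add_sum_of_osc {E : Type*} {n : ℕ} {f : (Fin n → E) → ℝ≥0∞} {c : Fin n → ℝ≥0∞}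
    (h : ∀ i x y, (∀ j, j ≠ i → x j = y j) → f x ≤ f y + c i) (x y : Fin n → E) :
    f x ≤ f y + ∑ i, c i := by
  classical
  -- The set `s` holds the coordinates already switched from `x` to `y`; each insertion costs one `c
  -- i`.
  have key : ∀ s : Finset (Fin n), f x ≤ f (s.piecewise y x) + ∑ i ∈ s, c i := by
    intro s
    induction s using Finset.induction_on with
    | empty => simp
    | insert a s ha ih =>
      rw [Finset.sum_insert ha, ← add_assoc]
      refine ih.trans ?_
      gcongr
      refine h a _ _ fun j hj => ?_
      rw [Finset.piecewise_insert, Function.update_of_ne hj]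
  simpa using key Finset.univ

/-! ### Selection -/

lemma lintegral_select {N : ℕ} {X : Type*} [MeasurableSpace X] (g : Generation N X)
    {φ : X → ℝ≥0∞} (hφ : Measurable φ) :
    ∫⁻ x, φ x ∂select N X g = ∑ i, ((g i).2 : ℝ≥0∞) / (∑ j, ((g j).2 : ℝ≥0∞)) * φ (g i).1 := by
  change ∫⁻ x, φ x ∂((categ fun i => (g i).2).map fun i => (g i).1) = _
  rw [lintegral_map hφ (measurable_of_finite _), categ]
  simp only [lintegral_finsetSum_measure, lintegral_smul_measure, lintegral_dirac, smul_eq_mul]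

/-- All the weights lie in `[a, b]`. -/
def WeightsIn {N : ℕ} {X : Type*} (a b : ℝ≥0) (g : Generation N X) : Prop :=
  ∀ i, a ≤ (g i).2 ∧ (g i).2 ≤ b

section Weights

variable {N : ℕ} {X : Type*} {a b : ℝ≥0} {g g' : Generation N X}

lemma WeightsIn.sum_ne_zero (h : WeightsIn a b g) (ha : 0 < a) (hN : 0 < N) :
    ∑ j, ((g j).2 : ℝ≥0∞) ≠ 0 := by
  intro h0
  rw [Finset.sum_eq_zero_iff] at h0
  have := h0 ⟨0, hN⟩ (Finset.mem_univ _)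
  have h1 := (h ⟨0, hN⟩).1
  rw [ENNReal.coe_eq_zero] at this
  rw [this] at h1
  exact absurd ha (not_lt.2 h1)

lemma sum_weights_ne_top (g : Generation N X) : ∑ j, ((g j).2 : ℝ≥0∞) ≠ ∞ := by simp

lemma WeightsIn.sum_div (h : WeightsIn a b g) (ha : 0 < a) (hN : 0 < N) :
    ∑ i, ((g i).2 : ℝ≥0∞) / (∑ j, ((g j).2 : ℝ≥0∞)) = 1 := by
  simp only [div_eq_mul_inv, ← Finset.sum_mul]
  exact ENNReal.mul_inv_cancel (h.sum_ne_zero ha hN) (sum_weights_ne_top g)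

lemma WeightsIn.le_sum (h : WeightsIn a b g) : (N : ℝ≥0∞) * a ≤ ∑ j, ((g j).2 : ℝ≥0∞) := by
  calc (N : ℝ≥0∞) * a = ∑ _j : Fin N, (a : ℝ≥0∞) := by simp
    _ ≤ _ := Finset.sum_le_sum fun j _ => by exact_mod_cast (h j).1

lemma WeightsIn.sum_le (h : WeightsIn a b g) : ∑ j, ((g j).2 : ℝ≥0∞) ≤ (N : ℝ≥0∞) * b := by
  calc ∑ j, ((g j).2 : ℝ≥0∞) ≤ ∑ _j : Fin N, (b : ℝ≥0∞) :=
        Finset.sum_le_sum fun j _ => by exact_mod_cast (h j).2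
    _ = _ := by simp

/-- A single particle has mass at most `1 / (ε N)`. -/
lemma WeightsIn.div_le (h : WeightsIn a b g) (ha : 0 < a) {ε : ℝ≥0}
    (hε : ε * b ≤ a) (hε0 : 0 < ε) (hN : 0 < N) {v : ℝ≥0∞} (hv : v ≤ b) :
    v / (∑ j, ((g j).2 : ℝ≥0∞)) ≤ ((ε : ℝ≥0∞) * N)⁻¹ := by
  have hN' : (N : ℝ≥0∞) ≠ 0 := by exact_mod_cast hN.ne'
  have hε' : (ε : ℝ≥0∞) ≠ 0 := by exact_mod_cast hε0.ne'
  rw [ENNReal.div_le_iff (h.sum_ne_zero ha hN) (sum_weights_ne_top g), mul_comm,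
    ← div_eq_mul_inv, ENNReal.le_div_iff_mul_le (Or.inl (mul_ne_zero hε' hN'))
      (Or.inl (ENNReal.mul_ne_top ENNReal.coe_ne_top (ENNReal.natCast_ne_top N)))]
  refine le_trans ?_ h.le_sum
  calc v * ((ε : ℝ≥0∞) * N) ≤ b * ((ε : ℝ≥0∞) * N) := by gcongr
    _ = N * ((ε * b : ℝ≥0) : ℝ≥0∞) := by push_cast; ring
    _ ≤ _ := by gcongr

variable [MeasurableSpace X]

lemma WeightsIn.select_univ (h : WeightsIn a b g) (ha : 0 < a) (hN : 0 < N) :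
    select N X g Set.univ = 1 := by
  rw [← lintegral_one, lintegral_select g measurable_const]
  simpa using h.sum_div ha hN

/-- Changing one particle changes the selected state with probability at most `1 / (ε N)`. -/
lemma WeightsIn.select_le (h : WeightsIn a b g) (h' : WeightsIn a b g') (ha : 0 < a)
    {ε : ℝ≥0} (hε : ε * b ≤ a) (hε0 : 0 < ε) (hN : 0 < N) {i : Fin N}
    (hi : ∀ j, j ≠ i → g j = g' j) {φ : X → ℝ≥0∞} (hφ : Measurable φ) {c : ℝ≥0∞}
    (hc : ∀ x y, φ x ≤ φ y + c) :
    ∫⁻ x, φ x ∂select N X g ≤ ∫⁻ x, φ x ∂select N X g' + ((ε : ℝ≥0∞) * N)⁻¹ * c := by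
  rw [lintegral_select g hφ, lintegral_select g' hφ]
  classical
  set W := ∑ j, ((g j).2 : ℝ≥0∞) with hW
  set W' := ∑ j, ((g' j).2 : ℝ≥0∞) with hW'
  have hb : ∀ j, ((g j).2 : ℝ≥0∞) ≤ b := fun j => by exact_mod_cast (h j).2
  have hb' : ∀ j, ((g' j).2 : ℝ≥0∞) ≤ b := fun j => by exact_mod_cast (h' j).2
  -- Common part of the two selection laws: the unchanged particles, normalised by the larger of the
  -- two total weights.
  refine sum_mul_le_of_overlap (u := fun j => if j = i then 0 else ((g j).2 : ℝ≥0∞) / max W W')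
    (h.sum_div ha hN) (h'.sum_div ha hN) ?_ ?_ ?_ ?_ (fun j k => hc _ _)
  · intro j
    split_ifs
    · exact zero_le
    · exact ENNReal.div_le_div_left (le_max_left _ _) _
  · intro j
    split_ifs with hj
    · exact zero_le
    · rw [hi j hj]
      exact ENNReal.div_le_div_left (le_max_right _ _) _
  -- For the generation with the larger total, the mass outside the common part is exactly that of
  -- particle `i`, which is at most `1 / (ε N)`.
  · rcases le_total W W' with hle | hle
    · rw [max_eq_right hle]
      calc 1 = ∑ j, ((g' j).2 : ℝ≥0∞) / W' := (h'.sum_div ha hN).symm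
        _ ≤ ∑ j, ((if j = i then 0 else ((g j).2 : ℝ≥0∞) / W') +
              if j = i then ((ε : ℝ≥0∞) * N)⁻¹ else 0) := by
            refine Finset.sum_le_sum fun j _ => ?_
            split_ifs with hj
            · rw [zero_add]; exact h'.div_le ha hε hε0 hN (hb' j)
            · rw [hi j hj, add_zero]
        _ = _ := by rw [Finset.sum_add_distrib]; simp
    · rw [max_eq_left hle]
      calc 1 = ∑ j, ((g j).2 : ℝ≥0∞) / W := (h.sum_div ha hN).symm
        _ ≤ ∑ j, ((if j = i then 0 else ((g j).2 : ℝ≥0∞) / W) +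
              if j = i then ((ε : ℝ≥0∞) * N)⁻¹ else 0) := by
            refine Finset.sum_le_sum fun j _ => ?_
            split_ifs with hj
            · rw [zero_add]; exact h.div_le ha hε hε0 hN (hb j)
            · rw [add_zero]
        _ = _ := by rw [Finset.sum_add_distrib]; simp
  · intro j
    split_ifs with hj
    · simp
    · rw [hi j hj]

/-- Two generations with the same states and with weights of ratio at least `ε`. -/
lemma WeightsIn.select_le_of_fst_eq (h : WeightsIn a b g) (h' : WeightsIn a b g') (ha : 0 < a)
    {ε : ℝ≥0} (hε : ε * b ≤ a) (hN : 0 < N) (hfst : ∀ i, (g i).1 = (g' i).1)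
    {φ φ' : X → ℝ≥0∞} (hφ : Measurable φ) (hφ' : Measurable φ') {c : ℝ≥0∞}
    (hle : ∀ x, φ x ≤ φ' x) (hc : ∀ x y, φ x ≤ φ' y + c) :
    ∫⁻ x, φ x ∂select N X g ≤ ∫⁻ x, φ' x ∂select N X g' + ((1 - ε : ℝ≥0) : ℝ≥0∞) * c := by
  rw [lintegral_select g hφ, lintegral_select g' hφ']
  have hN' : (N : ℝ≥0∞) ≠ 0 := by exact_mod_cast hN.ne'
  have key : ∀ g : Generation N X, WeightsIn a b g → ∀ i,
      (ε : ℝ≥0∞) / N ≤ ((g i).2 : ℝ≥0∞) / (∑ j, ((g j).2 : ℝ≥0∞)) := by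
    intro g h i
    rw [ENNReal.le_div_iff_mul_le (Or.inl (h.sum_ne_zero ha hN)) (Or.inl (sum_weights_ne_top g))]
    calc (ε : ℝ≥0∞) / N * ∑ j, ((g j).2 : ℝ≥0∞) ≤ ε / N * (N * b) := by gcongr; exact h.sum_le
      _ = ((ε * b : ℝ≥0) : ℝ≥0∞) := by
          rw [← mul_assoc, ENNReal.div_mul_cancel hN' (ENNReal.natCast_ne_top N)]; push_cast; rfl
      _ ≤ _ := by exact_mod_cast hε.trans (h i).1
  -- Every normalised weight is at least `ε / N`, so both laws dominate `ε` times the uniform law on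
  -- the particles.
  refine sum_mul_le_of_overlap (u := fun _ => (ε : ℝ≥0∞) / N)
    (h.sum_div ha hN) (h'.sum_div ha hN) (key g h) (key g' h') ?_ ?_ (fun j k => hc _ _)
  · simp only [Finset.sum_const, Finset.card_univ, Fintype.card_fin, nsmul_eq_mul]
    rw [ENNReal.mul_div_cancel hN' (ENNReal.natCast_ne_top N)]
    exact_mod_cast le_add_tsub
  · intro i
    gcongr
    rw [hfst i]
    exact hle _

end Weights

namespace Model

variable {X : Type*} [MeasurableSpace X] {μ : Measure X}

/-! ### Integration against the kernels of the algorithm -/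

/-- One step of the recursion defining `run`, with an arbitrary continuation `κ`. -/
noncomputable def step [SigmaFinite μ] (𝓜 : Model X μ) (N n t : ℕ)
    (κ : Kernel (Generation N X × (Fin n → X)) (Fin (n + 1) → X)) :
    Kernel (Generation N X × (Fin (n + 1) → X)) (Fin (n + 2) → X) :=
  ((κ ∘ₖ ((𝓜.nextGeneration N (t + 1)).comap
      (fun a : Generation N X × (Fin (n + 1) → X) => (a.1, a.2 0)) (by fun_prop) ×ₖ
        Kernel.deterministic (fun a i => a.2 i.succ) (by fun_prop))) ⊗ₖ
    ((𝓜.backward N t).comap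
      (fun p : (Generation N X × (Fin (n + 1) → X)) × (Fin (n + 1) → X) => (p.1.1, p.2 0))
      (by fun_prop))).map fun p => Fin.cons p.2 p.1

instance [SigmaFinite μ] (𝓜 : Model X μ) (N n t : ℕ)
    (κ : Kernel (Generation N X × (Fin n → X)) (Fin (n + 1) → X)) [IsFiniteKernel κ] :
    IsFiniteKernel (𝓜.step N n t κ) := by
  unfold step
  infer_instance

lemma run_succ [SigmaFinite μ] (𝓜 : Model X μ) (N n t : ℕ) :
    𝓜.run N (n + 1) t = 𝓜.step N n t (𝓜.run N n (t + 1)) := rfl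

/-- Integrating out the state at time `t` with respect to the backward sampling step. -/
noncomputable def integrateBackward (𝓜 : Model X μ) {N n : ℕ} (t : ℕ)
    (f : (Fin (n + 2) → X) → ℝ≥0∞) (g : Generation N X) (z : Fin (n + 1) → X) : ℝ≥0∞ :=
  ∫⁻ x, f (Fin.cons x z) ∂𝓜.backward N t (g, z 0)

lemma measurable_integrateBackward (𝓜 : Model X μ) {N n : ℕ} (t : ℕ)
    {f : (Fin (n + 2) → X) → ℝ≥0∞} (hf : Measurable f) :
    Measurable fun p : Generation N X × (Fin (n + 1) → X) =>
      𝓜.integrateBackward t f p.1 p.2 := by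
  have h : Measurable fun q : (Generation N X × (Fin (n + 1) → X)) × X =>
      f (Fin.cons q.2 q.1.2) :=
    hf.comp (measurable_finCons.comp
      ((measurable_snd.comp measurable_fst).prodMk measurable_snd))
  exact h.lintegral_kernel_prod_right'
    (κ := (𝓜.backward N t).comap (fun p : Generation N X × (Fin (n + 1) → X) => (p.1, p.2 0))
      (by fun_prop))

lemma measurable_integrateBackward_right (𝓜 : Model X μ) {N n : ℕ} (t : ℕ)
    {f : (Fin (n + 2) → X) → ℝ≥0∞} (hf : Measurable f) (g : Generation N X) :
    Measurable (𝓜.integrateBackward t f g) :=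
  (𝓜.measurable_integrateBackward t hf).comp (measurable_const.prodMk measurable_id)

lemma lintegral_step [SigmaFinite μ] (𝓜 : Model X μ) (N n t : ℕ)
    (κ : Kernel (Generation N X × (Fin n → X)) (Fin (n + 1) → X)) [IsFiniteKernel κ]
    {f : (Fin (n + 2) → X) → ℝ≥0∞} (hf : Measurable f) (g : Generation N X)
    (r : Fin (n + 1) → X) :
    ∫⁻ z, f z ∂𝓜.step N n t κ (g, r) =
      ∫⁻ g', ∫⁻ z, 𝓜.integrateBackward t f g z ∂κ (g', fun i => r i.succ)
        ∂𝓜.nextGeneration N (t + 1) (g, r 0) := by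
  have hfc : Measurable fun p : (Fin (n + 1) → X) × X => f (Fin.cons p.2 p.1) :=
    hf.comp measurable_finCons
  have hb := 𝓜.measurable_integrateBackward_right t hf g
  rw [step, Kernel.lintegral_map _ measurable_finCons _ hf, Kernel.lintegral_compProd _ _ _ hfc]
  simp only [Kernel.lintegral_comap]
  change ∫⁻ z, 𝓜.integrateBackward t f g z ∂_ = _
  rw [Kernel.lintegral_comp _ _ _ hb, Kernel.lintegral_prod _ _ _ hb.lintegral_kernel,
    Kernel.lintegral_comap]
  refine lintegral_congr fun g' => ?_
  rw [Kernel.lintegral_deterministic']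
  exact hb.lintegral_kernel.comp (measurable_const.prodMk measurable_id)

lemma lintegral_run_zero [SigmaFinite μ] (𝓜 : Model X μ) (N t : ℕ)
    {f : (Fin 1 → X) → ℝ≥0∞} (hf : Measurable f) (a : Generation N X × (Fin 0 → X)) :
    ∫⁻ z, f z ∂𝓜.run N 0 t a = ∫⁻ x, f (fun _ => x) ∂select N X a.1 := by
  rw [run, Kernel.lintegral_comap, Kernel.lintegral_map _ (by fun_prop) _ hf]

lemma lintegral_cbpf_succ [SigmaFinite μ] (𝓜 : Model X μ) (N n : ℕ)
    {f : (Fin (n + 1) → X) → ℝ≥0∞} (hf : Measurable f) (x : Fin (n + 1) → X) :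
    ∫⁻ z, f z ∂𝓜.cbpf N (n + 1) x =
      ∫⁻ g, ∫⁻ z, f z ∂𝓜.run N n 1 (g, fun i => x i.succ) ∂𝓜.initGeneration N (x 0) := by
  rw [cbpf, Kernel.lintegral_comp _ _ _ hf, Kernel.lintegral_prod _ _ _ hf.lintegral_kernel,
    Kernel.lintegral_comap]
  refine lintegral_congr fun g => ?_
  rw [Kernel.lintegral_deterministic']
  exact hf.lintegral_kernel.comp (measurable_const.prodMk measurable_id)

lemma lintegral_trans [SigmaFinite μ] (𝓜 : Model X μ) (t : ℕ) (x : X) {φ : X → ℝ≥0∞}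
    (hφ : Measurable φ) :
    ∫⁻ y, φ y ∂𝓜.trans t x = ∫⁻ y, (𝓜.M t x y : ℝ≥0∞) * φ y ∂μ := by
  have h : Measurable (Function.uncurry fun x y => (𝓜.M t x y : ℝ≥0∞)) :=
    (𝓜.measurable_M t).coe_nnreal_ennreal
  rw [trans, Kernel.lintegral_withDensity _ h _ hφ, Kernel.const_apply]

lemma lintegral_backward (𝓜 : Model X μ) {N : ℕ} (t : ℕ) (g : Generation N X) (y : X)
    {φ : X → ℝ≥0∞} :
    ∫⁻ x, φ x ∂𝓜.backward N t (g, y) =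
      ∫⁻ x, φ x ∂select N X (𝓜.backwardWeigh t (g, y)) := by
  rw [backward, Kernel.lintegral_comap]

/-- The law of a weighted particle at time `t` whose parent is selected from the generation `g`. -/
noncomputable def freeParticle [SigmaFinite μ] (𝓜 : Model X μ) {N : ℕ} (t : ℕ)
    (g : Generation N X) : Measure (X × ℝ≥0) :=
  (((Kernel.id ×ₖ 𝓜.trans t) ∘ₖ select N X).map (𝓜.weigh t)) g

lemma lintegral_freeParticle [SigmaFinite μ] (𝓜 : Model X μ) {N : ℕ} (t : ℕ)
    (g : Generation N X) {φ : X × ℝ≥0 → ℝ≥0∞} (hφ : Measurable φ) :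
    ∫⁻ a, φ a ∂𝓜.freeParticle t g =
      ∫⁻ x, ∫⁻ y, φ (y, 𝓜.G t x y) ∂𝓜.trans t x ∂select N X g := by
  have h : Measurable fun p => φ (𝓜.weigh t p) := hφ.comp (𝓜.measurable_weigh t)
  rw [freeParticle, Kernel.lintegral_map _ (𝓜.measurable_weigh t) _ hφ,
    Kernel.lintegral_comp _ _ _ h]
  refine lintegral_congr fun x => ?_
  rw [Kernel.lintegral_prod _ _ _ h, Kernel.id_apply, lintegral_dirac']
  · rfl
  · exact h.lintegral_kernel_prod_right' (κ := Kernel.prodMkLeft X (𝓜.trans t)|>.comap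
      (fun x' => (x', x)) (by fun_prop))

lemma measurable_lintegral_trans [SigmaFinite μ] (𝓜 : Model X μ) (t : ℕ)
    {φ : X × ℝ≥0 → ℝ≥0∞} (hφ : Measurable φ) :
    Measurable fun x => ∫⁻ y, φ (y, 𝓜.G t x y) ∂𝓜.trans t x :=
  (hφ.comp (𝓜.measurable_weigh t)).lintegral_kernel_prod_right'

lemma nextParticle_zero [SigmaFinite μ] (𝓜 : Model X μ) {m : ℕ} (t : ℕ)
    (a : Generation (m + 1) X × X) :
    𝓜.nextParticle t (0 : Fin (m + 1)) a = Measure.dirac (𝓜.weigh t ((a.1 0).1, a.2)) := by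
  simp [nextParticle, Kernel.deterministic_apply]

lemma nextParticle_succ [SigmaFinite μ] (𝓜 : Model X μ) {m : ℕ} (t : ℕ) (i : Fin m)
    (a : Generation (m + 1) X × X) :
    𝓜.nextParticle t i.succ a = 𝓜.freeParticle t a.1 := by
  simp [nextParticle, freeParticle, Kernel.comap_apply]

lemma initParticle_zero (𝓜 : Model X μ) {m : ℕ} (x : X) :
    𝓜.initParticle (0 : Fin (m + 1)) x = Measure.dirac (𝓜.weigh₁ x) := by
  simp [initParticle, Kernel.deterministic_apply]

lemma initParticle_succ (𝓜 : Model X μ) {m : ℕ} (i : Fin m) (x : X) :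
    𝓜.initParticle i.succ x = 𝓜.initLaw.map 𝓜.weigh₁ := by
  simp [initParticle, Kernel.map_apply _ 𝓜.measurable_weigh₁]

end Model

/-! ### Clamped weights -/

/-- Forcing the weight of a particle into `[a, b]`. -/
def clampWeight {X : Type*} (a b : ℝ≥0) (p : X × ℝ≥0) : X × ℝ≥0 := (p.1, max a (min p.2 b))

lemma measurable_clampWeight {X : Type*} [MeasurableSpace X] (a b : ℝ≥0) :
    Measurable (clampWeight (X := X) a b) := by
  unfold clampWeight
  fun_prop

lemma clampWeight_eq {X : Type*} {a b : ℝ≥0} {p : X × ℝ≥0} (ha : a ≤ p.2) (hb : p.2 ≤ b) :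
    clampWeight a b p = p := by
  simp [clampWeight, min_eq_left hb, max_eq_right ha]

lemma weightsIn_clampWeight {N : ℕ} {X : Type*} {a b : ℝ≥0} (hab : a ≤ b) (g : Generation N X) :
    WeightsIn a b fun i => clampWeight a b (g i) :=
  fun _ => ⟨le_max_left _ _, max_le hab (min_le_right _ _)⟩

/-- The law `p` of a weighted particle is carried by the weights in `[a, b]`. -/
def CarriedBy {X : Type*} [MeasurableSpace X] (a b : ℝ≥0) (p : Measure (X × ℝ≥0)) : Prop :=
  ∀ᵐ x ∂p, a ≤ x.2 ∧ x.2 ≤ b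

lemma measurableSet_weight_mem {X : Type*} [MeasurableSpace X] (a b : ℝ≥0) :
    MeasurableSet {x : X × ℝ≥0 | a ≤ x.2 ∧ x.2 ≤ b} :=
  (measurableSet_le measurable_const measurable_snd).inter
    (measurableSet_le (f := fun x : X × ℝ≥0 => x.2) measurable_snd measurable_const)

lemma ae_pi_weightsIn {N : ℕ} {X : Type*} [MeasurableSpace X] {a b : ℝ≥0}
    {p : Fin N → Measure (X × ℝ≥0)} [∀ i, IsProbabilityMeasure (p i)]
    (hp : ∀ i, CarriedBy a b (p i)) : ∀ᵐ g ∂Measure.pi p, WeightsIn a b g := by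
  unfold WeightsIn
  rw [ae_all_iff]
  intro i
  exact (Measure.quasiMeasurePreserving_eval p i).ae (hp i)

/-- The oscillation bound is only available for admissible weights, whereas exchanging factors one
by one requires it on all generations. Composing `F` with the clamping makes it global and changes
neither integral, since the laws are carried by weights in `[a, b]`. -/
lemma lintegral_pi_generation_le {N : ℕ} {X : Type*} [MeasurableSpace X] {a b : ℝ≥0}
    (hab : a ≤ b) (p q : Fin N → Measure (X × ℝ≥0)) [∀ i, IsProbabilityMeasure (p i)]
    [∀ i, IsProbabilityMeasure (q i)] (δ : Fin N → ℝ≥0∞)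
    (hpq : ∀ i, OscClose (p i) (q i) (δ i)) (hp : ∀ i, CarriedBy a b (p i))
    (hq : ∀ i, CarriedBy a b (q i)) {F : Generation N X → ℝ≥0∞} (hF : Measurable F) {L : ℝ≥0∞}
    (hL : ∀ i g g', WeightsIn a b g → WeightsIn a b g' → (∀ j, j ≠ i → g j = g' j) →
      F g ≤ F g' + L) :
    ∫⁻ g, F g ∂Measure.pi p ≤ ∫⁻ g, F g ∂Measure.pi q + (∑ i, δ i) * L := by
  have key : ∀ p : Fin N → Measure (X × ℝ≥0), (∀ i, IsProbabilityMeasure (p i)) →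
      (∀ i, CarriedBy a b (p i)) →
      ∫⁻ g, F g ∂Measure.pi p = ∫⁻ g, F (fun i => clampWeight a b (g i)) ∂Measure.pi p := by
    intro p _ hp
    refine lintegral_congr_ae ?_
    filter_upwards [ae_pi_weightsIn hp] with g hg
    congr 1
    exact funext fun i => (clampWeight_eq (hg i).1 (hg i).2).symm
  rw [key p inferInstance hp, key q inferInstance hq]
  refine lintegral_pi_le p q δ hpq (hF.comp (measurable_pi_lambda _ fun i =>
    (measurable_clampWeight a b).comp (measurable_pi_apply i))) fun i g g' hg => ?_
  exact hL i _ _ (weightsIn_clampWeight hab g) (weightsIn_clampWeight hab g')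
    fun j hj => congrArg (clampWeight a b) (hg j hj)

namespace Model

variable {X : Type*} [MeasurableSpace X] {μ : Measure X} {𝓜 : Model X μ}

lemma nonempty (𝓜 : Model X μ) : Nonempty X := by
  by_contra h
  rw [not_nonempty_iff] at h
  have := 𝓜.lintegral_M₁
  simp [Measure.eq_zero_of_isEmpty μ] at this

lemma div_mul_le_self' (a b : ℝ≥0) : a / b * b ≤ a := by
  rcases eq_or_ne b 0 with rfl | hb
  · simp
  · rw [div_mul_cancel₀ _ hb]

/-! ### Consequences of strong mixing -/

namespace StrongMixing

variable {T : ℕ} {ε : ℝ≥0}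

lemma G₁_mem (h : 𝓜.StrongMixing T ε) (x : X) : 𝓜.Glow 1 ≤ 𝓜.G₁ x ∧ 𝓜.G₁ x ≤ 𝓜.Gup 1 := by
  simp only [Glow, Gup, if_true]
  exact ⟨ciInf_le (OrderBot.bddBelow _) x, le_ciSup h.bddAbove_G₁ x⟩

lemma G_mem (h : 𝓜.StrongMixing T ε) {t : ℕ} (ht : 2 ≤ t) (htT : t ≤ T) (x y : X) :
    𝓜.Glow t ≤ 𝓜.G t x y ∧ 𝓜.G t x y ≤ 𝓜.Gup t := by
  have : t ≠ 1 := by omega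
  simp only [Glow, Gup, if_neg this]
  exact ⟨ciInf_le (OrderBot.bddBelow _) ((x, y) : X × X),
    le_ciSup (h.bddAbove_G t ht htT) ((x, y) : X × X)⟩

lemma M_mem (h : 𝓜.StrongMixing T ε) {t : ℕ} (ht : 2 ≤ t) (htT : t ≤ T) (x y : X) :
    𝓜.Mlow t ≤ 𝓜.M t x y ∧ 𝓜.M t x y ≤ 𝓜.Mup t :=
  ⟨ciInf_le (OrderBot.bddBelow _) ((x, y) : X × X),
    le_ciSup (h.bddAbove_M t ht htT) ((x, y) : X × X)⟩

lemma mul_Gup_le (h : 𝓜.StrongMixing T ε) {t : ℕ} (ht : 1 ≤ t) (htT : t ≤ T) :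
    ε * 𝓜.Gup t ≤ 𝓜.Glow t :=
  (mul_le_mul_left (h.le_delta t ht htT) _).trans (div_mul_le_self' _ _)

lemma Glow_le_Gup (h : 𝓜.StrongMixing T ε) {t : ℕ} (ht : 1 ≤ t) (htT : t ≤ T) :
    𝓜.Glow t ≤ 𝓜.Gup t := by
  obtain ⟨x⟩ := 𝓜.nonempty
  rcases eq_or_ne t 1 with rfl | h1
  · exact (h.G₁_mem x).1.trans (h.G₁_mem x).2
  · exact (h.G_mem (by omega) htT x x).1.trans (h.G_mem (by omega) htT x x).2

/-- The range of the backward sampling weights. -/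
lemma weightsIn_backwardWeigh (h : 𝓜.StrongMixing T ε) {N t : ℕ} (ht : 1 ≤ t) (htT : t < T)
    {g : Generation N X} (hg : WeightsIn (𝓜.Glow t) (𝓜.Gup t) g) (y : X) :
    WeightsIn (𝓜.Glow t * 𝓜.Mlow (t + 1) * 𝓜.Glow (t + 1))
      (𝓜.Gup t * 𝓜.Mup (t + 1) * 𝓜.Gup (t + 1)) (𝓜.backwardWeigh t (g, y)) := fun i => by
  have hM := h.M_mem (t := t + 1) (by omega) htT (g i).1 y
  have hG := h.G_mem (t := t + 1) (by omega) htT (g i).1 y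
  exact ⟨mul_le_mul' (mul_le_mul' (hg i).1 hM.1) hG.1, mul_le_mul' (mul_le_mul' (hg i).2 hM.2) hG.2⟩

lemma mul_backward_le (h : 𝓜.StrongMixing T ε) {t : ℕ} (ht : 1 ≤ t) (htT : t < T) :
    ε * (𝓜.Gup t * 𝓜.Mup (t + 1) * 𝓜.Gup (t + 1)) ≤
      𝓜.Glow t * 𝓜.Mlow (t + 1) * 𝓜.Glow (t + 1) :=
  (mul_le_mul_left (h.le_epsilon t ht htT) _).trans
    (div_mul_le_self' _ _)

lemma backward_pos (h : 𝓜.StrongMixing T ε) {t : ℕ} (ht : 1 ≤ t) (htT : t < T) :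
    0 < 𝓜.Glow t * 𝓜.Mlow (t + 1) * 𝓜.Glow (t + 1) :=
  mul_pos (mul_pos (h.Glow_pos t ht htT.le) (h.Mlow_pos (t + 1) (by omega) htT))
    (h.Glow_pos (t + 1) (by omega) htT)

end StrongMixing

/-- A generation at time `t` whose weights lie between the bounds of the potential. -/
def Good (𝓜 : Model X μ) {N : ℕ} (t : ℕ) (g : Generation N X) : Prop :=
  WeightsIn (𝓜.Glow t) (𝓜.Gup t) g

/-! ### The next generation -/

section Init

variable {T N : ℕ} {ε : ℝ≥0}

lemma initGeneration_apply (m : ℕ) (x : X) :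
    𝓜.initGeneration (m + 1) x = Measure.pi fun i => 𝓜.initParticle i x := rfl

/-- Only the reference particle sees the reference state, so the total discrepancy is that of one
particle, irrespective of their number. -/
lemma oscClose_initParticle {m : ℕ} (x x' : X) (i : Fin (m + 1)) :
    OscClose (𝓜.initParticle i x) (𝓜.initParticle i x') (if i = 0 then 1 else 0) := by
  refine Fin.cases ?_ (fun i => ?_) i
  · rw [initParticle_zero, initParticle_zero, if_pos rfl]
    exact oscClose_one _ _
  · rw [initParticle_succ, initParticle_succ, if_neg (Fin.succ_ne_zero i)]
    exact oscClose_self _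

lemma carriedBy_initParticle (h : 𝓜.StrongMixing T ε) {m : ℕ} (i : Fin (m + 1)) (x : X) :
    CarriedBy (𝓜.Glow 1) (𝓜.Gup 1) (𝓜.initParticle i x) := by
  refine Fin.cases ?_ (fun i => ?_) i
  · rw [initParticle_zero, CarriedBy, ae_dirac_iff (measurableSet_weight_mem _ _)]
    exact h.G₁_mem _
  · rw [initParticle_succ, CarriedBy, ae_map_iff 𝓜.measurable_weigh₁.aemeasurable
      (measurableSet_weight_mem _ _)]
    exact ae_of_all _ fun x => h.G₁_mem x

lemma lintegral_initGeneration_le (h : 𝓜.StrongMixing T ε) (hT : 1 ≤ T) {m : ℕ} (y y' : X)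
    {F : Generation (m + 1) X → ℝ≥0∞} (hF : Measurable F) {L : ℝ≥0∞}
    (hL : ∀ i g g', 𝓜.Good 1 g → 𝓜.Good 1 g' → (∀ j, j ≠ i → g j = g' j) → F g ≤ F g' + L) :
    ∫⁻ g₁, F g₁ ∂𝓜.initGeneration (m + 1) y ≤
      ∫⁻ g₁, F g₁ ∂𝓜.initGeneration (m + 1) y' + L := by
  rw [initGeneration_apply, initGeneration_apply]
  have := lintegral_pi_generation_le (h.Glow_le_Gup le_rfl hT) _ _ _
    (oscClose_initParticle (𝓜 := 𝓜) (m := m) y y')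
    (fun i => carriedBy_initParticle h i _) (fun i => carriedBy_initParticle h i _) hF hL
  simpa using this

lemma ae_good_initGeneration (h : 𝓜.StrongMixing T ε) (m : ℕ) (y : X) :
    ∀ᵐ g' ∂𝓜.initGeneration (m + 1) y, 𝓜.Good 1 g' :=
  ae_pi_weightsIn fun i => carriedBy_initParticle h i _

lemma select_univ_le (g : Generation N X) : select N X g Set.univ ≤ 1 := by
  change ((categ fun i => (g i).2).map fun i => (g i).1) Set.univ ≤ 1
  rw [Measure.map_apply (measurable_of_finite _) MeasurableSet.univ]
  exact categ_univ_le _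

end Init

section Next

variable [SigmaFinite μ] {T N : ℕ} {ε : ℝ≥0}

lemma freeParticle_univ (t : ℕ) (g : Generation N X) :
    𝓜.freeParticle t g Set.univ = select N X g Set.univ := by
  rw [← lintegral_one, lintegral_freeParticle _ _ _ measurable_const]
  simp

lemma isProbabilityMeasure_freeParticle (h : 𝓜.StrongMixing T ε) (hN : 0 < N) {t : ℕ} (s : ℕ)
    (ht : 1 ≤ t) (htT : t ≤ T) {g : Generation N X} (hg : 𝓜.Good t g) :
    IsProbabilityMeasure (𝓜.freeParticle s g) :=
  ⟨by rw [freeParticle_univ, hg.select_univ (h.Glow_pos t ht htT) hN]⟩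

lemma carriedBy_freeParticle (h : 𝓜.StrongMixing T ε) {t : ℕ} (ht : 2 ≤ t) (htT : t ≤ T)
    (g : Generation N X) : CarriedBy (𝓜.Glow t) (𝓜.Gup t) (𝓜.freeParticle t g) := by
  have hs := measurableSet_weight_mem (X := X) (𝓜.Glow t) (𝓜.Gup t)
  rw [CarriedBy, ae_iff]
  change 𝓜.freeParticle t g {x : X × ℝ≥0 | 𝓜.Glow t ≤ x.2 ∧ x.2 ≤ 𝓜.Gup t}ᶜ = 0
  rw [← lintegral_indicator_one hs.compl,
    lintegral_freeParticle _ _ _ (measurable_one.indicator hs.compl)]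
  simp [Set.indicator, h.G_mem ht htT]

lemma carriedBy_nextParticle (h : 𝓜.StrongMixing T ε) {m t : ℕ} (ht : 2 ≤ t) (htT : t ≤ T)
    (i : Fin (m + 1)) (a : Generation (m + 1) X × X) :
    CarriedBy (𝓜.Glow t) (𝓜.Gup t) (𝓜.nextParticle t i a) := by
  refine Fin.cases ?_ (fun i => ?_) i
  · rw [nextParticle_zero, CarriedBy, ae_dirac_iff (measurableSet_weight_mem _ _)]
    exact h.G_mem ht htT _ _
  · rw [nextParticle_succ]
    exact carriedBy_freeParticle h ht htT _

lemma isProbabilityMeasure_nextParticle (h : 𝓜.StrongMixing T ε) {m t : ℕ} (s : ℕ)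
    (ht : 1 ≤ t) (htT : t ≤ T) {g : Generation (m + 1) X} (hg : 𝓜.Good t g) (y : X)
    (i : Fin (m + 1)) : IsProbabilityMeasure (𝓜.nextParticle s i (g, y)) := by
  refine Fin.cases ?_ (fun i => ?_) i
  · rw [nextParticle_zero]
    infer_instance
  · rw [nextParticle_succ]
    exact isProbabilityMeasure_freeParticle h (Nat.succ_pos m) s ht htT hg

lemma nextGeneration_apply (m t : ℕ) (a : Generation (m + 1) X × X) :
    𝓜.nextGeneration (m + 1) t a = Measure.pi fun i => 𝓜.nextParticle t i a := rfl

lemma nextGeneration_univ (h : 𝓜.StrongMixing T ε) {m t : ℕ} (s : ℕ)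
    (ht : 1 ≤ t) (htT : t ≤ T) {g : Generation (m + 1) X} (hg : 𝓜.Good t g) (y : X) :
    𝓜.nextGeneration (m + 1) s (g, y) Set.univ = 1 := by
  have := isProbabilityMeasure_nextParticle h s ht htT hg y
  rw [nextGeneration_apply]
  exact measure_univ

lemma nextParticle_univ_le {m : ℕ} (t : ℕ) (i : Fin (m + 1)) (a : Generation (m + 1) X × X) :
    𝓜.nextParticle t i a Set.univ ≤ 1 := by
  refine Fin.cases ?_ (fun i => ?_) i
  · rw [nextParticle_zero]
    simp
  · rw [nextParticle_succ, freeParticle_univ]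
    exact select_univ_le _

lemma nextGeneration_univ_le (m t : ℕ) (a : Generation (m + 1) X × X) :
    𝓜.nextGeneration (m + 1) t a Set.univ ≤ 1 := by
  rw [nextGeneration_apply, Measure.pi_univ]
  exact Finset.prod_le_one' fun i _ => nextParticle_univ_le t i a

lemma ae_good_nextGeneration (h : 𝓜.StrongMixing T ε) {m t : ℕ}
    (ht : 1 ≤ t) (htT : t < T) {g : Generation (m + 1) X} (hg : 𝓜.Good t g) (y : X) :
    ∀ᵐ g' ∂𝓜.nextGeneration (m + 1) (t + 1) (g, y), 𝓜.Good (t + 1) g' := by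
  have := isProbabilityMeasure_nextParticle h (t + 1) ht htT.le hg y
  rw [nextGeneration_apply]
  exact ae_pi_weightsIn fun i => carriedBy_nextParticle h (by omega) htT i _

/-- The generation enters only through the selection of the parent; moving and weighing the particle
afterwards cannot increase oscillation. -/
lemma oscClose_freeParticle (h : 𝓜.StrongMixing T ε) (hε : 0 < ε) (hN : 0 < N) {t : ℕ} (s : ℕ)
    (ht : 1 ≤ t) (htT : t ≤ T) {g g' : Generation N X} (hg : 𝓜.Good t g) (hg' : 𝓜.Good t g')
    {i : Fin N} (hi : ∀ j, j ≠ i → g j = g' j) :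
    OscClose (𝓜.freeParticle s g) (𝓜.freeParticle s g') ((ε : ℝ≥0∞) * N)⁻¹ := by
  intro φ c hφ hc
  rw [lintegral_freeParticle _ _ _ hφ, lintegral_freeParticle _ _ _ hφ]
  exact hg.select_le hg' (h.Glow_pos t ht htT) (h.mul_Gup_le ht htT) hε hN hi
    (𝓜.measurable_lintegral_trans s hφ)
    fun x y => lintegral_le_add_of_osc (𝓜.trans s x) (𝓜.trans s y) fun _ _ => hc _ _

/-- The reference particle gets the trivial constant: its weight depends on the state of its parent,
which may be the changed particle. The other particles feel the change only if their parent
selection does. -/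
lemma oscClose_nextParticle (h : 𝓜.StrongMixing T ε) (hε : 0 < ε) {m t : ℕ} (s : ℕ)
    (ht : 1 ≤ t) (htT : t ≤ T) {g g' : Generation (m + 1) X} (hg : 𝓜.Good t g)
    (hg' : 𝓜.Good t g') {k : Fin (m + 1)} (hk : ∀ j, j ≠ k → g j = g' j) (y : X)
    (i : Fin (m + 1)) :
    OscClose (𝓜.nextParticle s i (g, y)) (𝓜.nextParticle s i (g', y))
      ((if i = 0 then 1 else 0) + ((ε : ℝ≥0∞) * (m + 1 : ℕ))⁻¹) := by
  refine Fin.cases ?_ (fun i => ?_) i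
  · rw [nextParticle_zero, nextParticle_zero]
    intro φ c hφ hc
    refine (oscClose_one (Measure.dirac (𝓜.weigh s ((g 0).1, y)))
      (Measure.dirac (𝓜.weigh s ((g' 0).1, y))) φ c hφ hc).trans ?_
    gcongr
    simp
  · rw [nextParticle_succ, nextParticle_succ, if_neg (Fin.succ_ne_zero i), zero_add]
    exact oscClose_freeParticle h hε (Nat.succ_pos m) s ht htT hg hg' hk

lemma oscClose_nextParticle_ref {m : ℕ} (s : ℕ) (g : Generation (m + 1) X) (y y' : X)
    (i : Fin (m + 1)) :
    OscClose (𝓜.nextParticle s i (g, y)) (𝓜.nextParticle s i (g, y'))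
      (if i = 0 then 1 else 0) := by
  refine Fin.cases ?_ (fun i => ?_) i
  · rw [nextParticle_zero, nextParticle_zero, if_pos rfl]
    exact oscClose_one _ _
  · rw [nextParticle_succ, nextParticle_succ, if_neg (Fin.succ_ne_zero i)]
    exact oscClose_self _

/-- Changing one particle of a generation. -/
lemma lintegral_nextGeneration_le (h : 𝓜.StrongMixing T ε) (hε : 0 < ε) {m t : ℕ}
    (ht : 1 ≤ t) (htT : t < T) {g g' : Generation (m + 1) X} (hg : 𝓜.Good t g)
    (hg' : 𝓜.Good t g') {k : Fin (m + 1)} (hk : ∀ j, j ≠ k → g j = g' j) (y : X)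
    {F : Generation (m + 1) X → ℝ≥0∞} (hF : Measurable F) {L : ℝ≥0∞}
    (hL : ∀ i g g', 𝓜.Good (t + 1) g → 𝓜.Good (t + 1) g' → (∀ j, j ≠ i → g j = g' j) →
      F g ≤ F g' + L) :
    ∫⁻ g₁, F g₁ ∂𝓜.nextGeneration (m + 1) (t + 1) (g, y) ≤
      ∫⁻ g₁, F g₁ ∂𝓜.nextGeneration (m + 1) (t + 1) (g', y) + (1 + (ε : ℝ≥0∞)⁻¹) * L := by
  have := isProbabilityMeasure_nextParticle h (t + 1) ht htT.le hg y
  have := isProbabilityMeasure_nextParticle h (t + 1) ht htT.le hg' y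
  -- The reference contributes `1`; the `m + 1` terms `1 / (ε (m + 1))`, one of them superfluous for
  -- the reference, add up to `1 / ε`, free of the number of particles.
  have hsum : ∑ i : Fin (m + 1), ((if i = 0 then 1 else 0) + ((ε : ℝ≥0∞) * (m + 1 : ℕ))⁻¹) =
      1 + (ε : ℝ≥0∞)⁻¹ := by
    rw [Finset.sum_add_distrib]
    simp only [Finset.sum_ite_eq', Finset.mem_univ, if_true, Finset.sum_const, Finset.card_univ,
      Fintype.card_fin, nsmul_eq_mul]
    rw [ENNReal.mul_inv (Or.inr (ENNReal.natCast_ne_top _)) (Or.inl ENNReal.coe_ne_top),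
      mul_left_comm, ENNReal.mul_inv_cancel (by simp) (ENNReal.natCast_ne_top _), mul_one]
  rw [nextGeneration_apply, nextGeneration_apply, ← hsum]
  exact lintegral_pi_generation_le (h.Glow_le_Gup (by omega) htT) _ _ _
    (oscClose_nextParticle h hε (t + 1) ht htT.le hg hg' hk y)
    (fun i => carriedBy_nextParticle h (by omega) htT i _)
    (fun i => carriedBy_nextParticle h (by omega) htT i _) hF hL

/-- Changing the reference state. -/
lemma lintegral_nextGeneration_ref_le (h : 𝓜.StrongMixing T ε) {m t : ℕ}
    (ht : 1 ≤ t) (htT : t < T) {g : Generation (m + 1) X} (hg : 𝓜.Good t g) (y y' : X)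
    {F : Generation (m + 1) X → ℝ≥0∞} (hF : Measurable F) {L : ℝ≥0∞}
    (hL : ∀ i g g', 𝓜.Good (t + 1) g → 𝓜.Good (t + 1) g' → (∀ j, j ≠ i → g j = g' j) →
      F g ≤ F g' + L) :
    ∫⁻ g₁, F g₁ ∂𝓜.nextGeneration (m + 1) (t + 1) (g, y) ≤
      ∫⁻ g₁, F g₁ ∂𝓜.nextGeneration (m + 1) (t + 1) (g, y') + L := by
  have := isProbabilityMeasure_nextParticle h (t + 1) ht htT.le hg y
  have := isProbabilityMeasure_nextParticle h (t + 1) ht htT.le hg y'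
  rw [nextGeneration_apply, nextGeneration_apply]
  have := lintegral_pi_generation_le (h.Glow_le_Gup (by omega) htT) _ _ _
    (oscClose_nextParticle_ref (𝓜 := 𝓜) (t + 1) g y y')
    (fun i => carriedBy_nextParticle h (by omega) htT i _)
    (fun i => carriedBy_nextParticle h (by omega) htT i _) hF hL
  simpa using this

end Next

end Model

/-! ### Functions with geometrically decreasing coordinatewise oscillations -/

/-- The oscillation of `f` in the coordinate `0` is at most `K w`, and in the coordinate `j ≥ 1` at
most `w a ^ j`. -/
structure Tame {X : Type*} {n : ℕ} (K a w : ℝ≥0∞) (f : (Fin (n + 1) → X) → ℝ≥0∞) : Prop where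
  zero : ∀ x y, (∀ j, j ≠ 0 → x j = y j) → f x ≤ f y + K * w
  succ : ∀ (j : Fin n) x y, (∀ i, i ≠ j.succ → x i = y i) → f x ≤ f y + w * a ^ (j + 1 : ℕ)

lemma sum_pow_le (a : ℝ≥0∞) (n : ℕ) : ∑ i : Fin n, a ^ (i : ℕ) ≤ (1 - a)⁻¹ := by
  rw [Fin.sum_univ_eq_sum_range (fun i => a ^ i), ← ENNReal.tsum_geometric]
  exact ENNReal.sum_le_tsum _

lemma Tame.osc {X : Type*} {n : ℕ} {K a w : ℝ≥0∞} {f : (Fin (n + 1) → X) → ℝ≥0∞}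
    (hf : Tame K a w f) (ha : a ≤ 1) (x y : Fin (n + 1) → X) :
    f x ≤ f y + (K + (1 - a)⁻¹) * w := by
  refine (le_add_sum_of_osc
    (c := Fin.cons (K * w) fun j : Fin n => w * a ^ (j + 1 : ℕ)) (f := f) ?_ x y).trans ?_
  · intro i
    refine Fin.cases ?_ (fun j => ?_) i
    · simpa using hf.zero
    · simpa using hf.succ j
  · rw [Fin.sum_univ_succ]
    simp only [Fin.cons_zero, Fin.cons_succ]
    rw [← Finset.mul_sum, add_mul, mul_comm w]
    gcongr
    refine le_trans (Finset.sum_le_sum fun j _ => ?_) (sum_pow_le a n)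
    exact pow_le_pow_right_of_le_one' ha (Nat.le_succ _)

lemma Tame.cons_le {X : Type*} {n : ℕ} {K a w : ℝ≥0∞} {f : (Fin (n + 1) → X) → ℝ≥0∞} (hf : Tame K a w f)
    (z : Fin n → X) (x x' : X) : f (Fin.cons x z) ≤ f (Fin.cons x' z) + K * w :=
  hf.zero _ _ fun j => Fin.cases (fun h => absurd rfl h) (fun j _ => by simp) j

lemma Tame.cons_le_succ {X : Type*} {n : ℕ} {K a w : ℝ≥0∞} {f : (Fin (n + 1) → X) → ℝ≥0∞}
    (hf : Tame K a w f) (j : Fin n) {z z' : Fin n → X} (hz : ∀ i, i ≠ j → z i = z' i) (x : X) :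
    f (Fin.cons x z) ≤ f (Fin.cons x z') + w * a ^ (j + 1 : ℕ) :=
  hf.succ j _ _ fun i => Fin.cases (fun _ => by simp)
    (fun i hi => by simpa using hz i fun h => hi (by rw [h])) i

namespace Model

variable {X : Type*} [MeasurableSpace X] {μ : Measure X} {𝓜 : Model X μ} {T : ℕ} {ε : ℝ≥0}

/-! ### Backward sampling -/

lemma backward_univ (h : 𝓜.StrongMixing T ε) {N t : ℕ} (hN : 0 < N) (ht : 1 ≤ t) (htT : t < T)
    {g : Generation N X} (hg : 𝓜.Good t g) (y : X) : 𝓜.backward N t (g, y) Set.univ = 1 := by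
  rw [backward, Kernel.comap_apply]
  exact (h.weightsIn_backwardWeigh ht htT hg y).select_univ (h.backward_pos ht htT) hN

lemma backward_univ_le {N : ℕ} (t : ℕ) (a : Generation N X × X) :
    𝓜.backward N t a Set.univ ≤ 1 := by
  rw [backward, Kernel.comap_apply]
  exact select_univ_le _

/-- Backward sampling forgets the state at time `t + 1`. -/
lemma lintegral_backward_le (h : 𝓜.StrongMixing T ε) {N t : ℕ} (hN : 0 < N) (ht : 1 ≤ t)
    (htT : t < T) {g : Generation N X} (hg : 𝓜.Good t g) (y y' : X) {φ φ' : X → ℝ≥0∞}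
    (hφ : Measurable φ) (hφ' : Measurable φ') {c : ℝ≥0∞} (hle : ∀ x, φ x ≤ φ' x)
    (hc : ∀ x x', φ x ≤ φ' x' + c) :
    ∫⁻ x, φ x ∂𝓜.backward N t (g, y) ≤
      ∫⁻ x, φ' x ∂𝓜.backward N t (g, y') + ((1 - ε : ℝ≥0) : ℝ≥0∞) * c := by
  rw [lintegral_backward, lintegral_backward]
  exact (h.weightsIn_backwardWeigh ht htT hg y).select_le_of_fst_eq
    (h.weightsIn_backwardWeigh ht htT hg y') (h.backward_pos ht htT) (h.mul_backward_le ht htT) hN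
    (fun i => rfl) hφ hφ' hle hc

/-- Backward sampling depends little on each particle. -/
lemma lintegral_backward_generation_le (h : 𝓜.StrongMixing T ε) (hε : 0 < ε) {N t : ℕ}
    (hN : 0 < N) (ht : 1 ≤ t) (htT : t < T) {g g' : Generation N X} (hg : 𝓜.Good t g)
    (hg' : 𝓜.Good t g') {i : Fin N} (hi : ∀ j, j ≠ i → g j = g' j) (y : X) {φ : X → ℝ≥0∞}
    (hφ : Measurable φ) {c : ℝ≥0∞} (hc : ∀ x x', φ x ≤ φ x' + c) :
    ∫⁻ x, φ x ∂𝓜.backward N t (g, y) ≤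
      ∫⁻ x, φ x ∂𝓜.backward N t (g', y) + ((ε : ℝ≥0∞) * N)⁻¹ * c := by
  rw [lintegral_backward, lintegral_backward]
  refine (h.weightsIn_backwardWeigh ht htT hg y).select_le
    (h.weightsIn_backwardWeigh ht htT hg' y) (h.backward_pos ht htT) (h.mul_backward_le ht htT) hε
    hN (i := i) (fun j hj => ?_) hφ hc
  simp [backwardWeigh, hi j hj]

lemma measurable_cons_left {n : ℕ} {f : (Fin (n + 1) → X) → ℝ≥0∞} (hf : Measurable f)
    (z : Fin n → X) : Measurable fun x => f (Fin.cons x z) :=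
  hf.comp (measurable_finCons.comp (measurable_const.prodMk measurable_id))

/-- The first remaining state plays two roles: as a coordinate of `f` it contributes `w a`, and as
the state steering backward sampling it contributes `(1 - ε) K w`. The condition `hK` says that the
sum is at most `K (w a)`. Later states do not enter the backward weights, so for them only the
exponent shifts by one, which is the factor `a` in the new weight. -/
lemma tame_integrateBackward (h : 𝓜.StrongMixing T ε) {N n t : ℕ} (hN : 0 < N) (ht : 1 ≤ t)
    (htT : t < T) {g : Generation N X} (hg : 𝓜.Good t g) {K a w : ℝ≥0∞}
    (hK : a + ((1 - ε : ℝ≥0) : ℝ≥0∞) * K ≤ K * a) {f : (Fin (n + 2) → X) → ℝ≥0∞}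
    (hfm : Measurable f) (hf : Tame K a w f) :
    Tame K a (w * a) (𝓜.integrateBackward t f g) := by
  have hsub : ∀ y, 𝓜.backward N t (g, y) Set.univ ≤ 1 := fun y => backward_univ_le t _
  constructor
  · intro z z' hz
    have hc := Tame.cons_le_succ hf 0 hz
    calc 𝓜.integrateBackward t f g z
        ≤ ∫⁻ x, (f (Fin.cons x z') + w * a ^ ((0 : Fin (n + 1)) + 1 : ℕ))
            ∂𝓜.backward N t (g, z 0) := lintegral_mono hc
      _ ≤ ∫⁻ x, f (Fin.cons x z') ∂𝓜.backward N t (g, z 0) + w * a :=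
          (lintegral_le_add_of_le _ (hsub _) (ae_of_all _ fun x => le_rfl)).trans (by simp)
      _ ≤ 𝓜.integrateBackward t f g z' + ((1 - ε : ℝ≥0) : ℝ≥0∞) * (K * w) + w * a := by
          gcongr
          exact lintegral_backward_le h hN ht htT hg _ _ (measurable_cons_left hfm _)
            (measurable_cons_left hfm _) (fun _ => le_rfl) (Tame.cons_le hf z')
      _ = 𝓜.integrateBackward t f g z' + (a + ((1 - ε : ℝ≥0) : ℝ≥0∞) * K) * w := by ring
      _ ≤ 𝓜.integrateBackward t f g z' + K * (w * a) := by
          rw [mul_comm w a, ← mul_assoc]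
          gcongr
  · intro j z z' hz
    have h0 : z 0 = z' 0 := hz 0 (Fin.succ_ne_zero j).symm
    rw [integrateBackward, integrateBackward, h0]
    refine lintegral_le_add_of_le _ (hsub _) (ae_of_all _ fun x => ?_)
    refine (Tame.cons_le_succ hf j.succ hz x).trans (le_of_eq ?_)
    rw [Fin.val_succ]
    ring

/-! ### Total masses -/

variable [SigmaFinite μ]

lemma step_univ_le {m n t : ℕ} {κ : Kernel (Generation (m + 1) X × (Fin n → X)) (Fin (n + 1) → X)}
    [IsFiniteKernel κ] (hκ : ∀ a, κ a Set.univ ≤ 1)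
    (a : Generation (m + 1) X × (Fin (n + 1) → X)) :
    𝓜.step (m + 1) n t κ a Set.univ ≤ 1 := by
  obtain ⟨g, r⟩ := a
  rw [← lintegral_one, lintegral_step _ _ _ _ _ measurable_const]
  have hone : ∀ {E : Type _} [MeasurableSpace E] (p : Measure E) (f : E → ℝ≥0∞),
      p Set.univ ≤ 1 → (∀ x, f x ≤ 1) → ∫⁻ x, f x ∂p ≤ 1 := fun p f hp hf =>
    (lintegral_mono hf).trans (by simpa using hp)
  refine hone _ _ (nextGeneration_univ_le m _ _) fun g' => hone _ _ (hκ _) fun z => ?_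
  simpa [integrateBackward] using backward_univ_le (𝓜 := 𝓜) t (g, z 0)

/-- Mass can be lost only by selecting from a generation whose weights all vanish. Strong mixing
excludes this from a good generation on, almost surely. -/
lemma run_univ (h : 𝓜.StrongMixing T ε) {m n t : ℕ} (ht : 1 ≤ t) (htT : t + n ≤ T)
    {g : Generation (m + 1) X} (hg : 𝓜.Good t g) (r : Fin n → X) :
    𝓜.run (m + 1) n t (g, r) Set.univ = 1 := by
  induction n generalizing t g with
  | zero =>
    rw [← lintegral_one, lintegral_run_zero _ _ _ measurable_const, lintegral_one]
    exact hg.select_univ (h.Glow_pos t ht (by omega)) (Nat.succ_pos m)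
  | succ n ih =>
    rw [run_succ, ← lintegral_one, lintegral_step _ _ _ _ _ measurable_const]
    have hb : 𝓜.integrateBackward t (fun _ : Fin (n + 2) → X => 1) g = fun _ => 1 := by
      funext z
      simpa [integrateBackward] using backward_univ h (Nat.succ_pos m) ht (by omega) hg (z 0)
    rw [hb]
    have : ∀ᵐ g' ∂𝓜.nextGeneration (m + 1) (t + 1) (g, r 0),
        ∫⁻ _, 1 ∂𝓜.run (m + 1) n (t + 1) (g', fun i => r i.succ) = 1 := by
      filter_upwards [ae_good_nextGeneration h ht (by omega) hg (r 0)] with g' hg'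
      rw [lintegral_one]
      exact ih (by omega) (by omega) hg' _
    rw [lintegral_congr_ae this, lintegral_one]
    exact nextGeneration_univ h (t + 1) ht (by omega) hg _

/-! ### Truncation of the recursion -/

/-- The algorithm `run`, stopped after `d` steps of its recursion, when it outputs a constant
trajectory. -/
noncomputable def truncatedRun (𝓜 : Model X μ) (N : ℕ) (x₀ : X) :
    (d n t : ℕ) → Kernel (Generation N X × (Fin n → X)) (Fin (n + 1) → X)
  | 0, _, _ => Kernel.const _ (Measure.dirac fun _ => x₀)
  | _ + 1, 0, t => 𝓜.run N 0 t
  | d + 1, n + 1, t => 𝓜.step N n t (truncatedRun 𝓜 N x₀ d n (t + 1))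

instance (N : ℕ) (x₀ : X) (d n t : ℕ) : IsFiniteKernel (𝓜.truncatedRun N x₀ d n t) := by
  induction d generalizing n t with
  | zero => unfold truncatedRun; infer_instance
  | succ d ih => cases n <;> (unfold truncatedRun; infer_instance)

lemma truncatedRun_univ_le {m : ℕ} (x₀ : X) (d n t : ℕ)
    (a : Generation (m + 1) X × (Fin n → X)) :
    𝓜.truncatedRun (m + 1) x₀ d n t a Set.univ ≤ 1 := by
  induction d generalizing n t with
  | zero => simp [truncatedRun]
  | succ d ih =>
    cases n with
    | zero =>
      rw [truncatedRun, ← lintegral_one, lintegral_run_zero _ _ _ measurable_const, lintegral_one]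
      exact select_univ_le _
    | succ n => exact step_univ_le (fun a => ih n (t + 1) a) a

/-- The Lipschitz constant of the truncated algorithm in each particle of its initial generation. -/
noncomputable def lipConst (ε K a : ℝ≥0∞) (N : ℕ) : ℕ → ℝ≥0∞
  | 0 => 0
  | d + 1 => (ε * N)⁻¹ * K + (1 + ε⁻¹) * a * lipConst ε K a N d

/-- Two effects of the changed particle are added: on the backward selection at time `t`, whose
integrand has oscillation `K w`, and on the law of the next generation, from which the induction
continues with weight `w a` and depth `d`. At depth `0` the output ignores the generation, which is
why `lipConst` starts at zero. -/
lemma truncatedRun_le (h : 𝓜.StrongMixing T ε) (hε : 0 < ε) {m : ℕ} (x₀ : X) {K a : ℝ≥0∞}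
    (hK : a + ((1 - ε : ℝ≥0) : ℝ≥0∞) * K ≤ K * a) (d : ℕ) {n t : ℕ} (ht : 1 ≤ t)
    (htT : t + n ≤ T) {w : ℝ≥0∞} {f : (Fin (n + 1) → X) → ℝ≥0∞} (hfm : Measurable f)
    (hf : Tame K a w f) {g g' : Generation (m + 1) X} (hg : 𝓜.Good t g) (hg' : 𝓜.Good t g')
    {i : Fin (m + 1)} (hi : ∀ j, j ≠ i → g j = g' j) (r : Fin n → X) :
    ∫⁻ z, f z ∂𝓜.truncatedRun (m + 1) x₀ d n t (g, r) ≤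
      ∫⁻ z, f z ∂𝓜.truncatedRun (m + 1) x₀ d n t (g', r) + lipConst ε K a (m + 1) d * w := by
  induction d generalizing n t g g' i w with
  | zero => simp [truncatedRun]
  | succ d ih =>
    cases n with
    | zero =>
      rw [truncatedRun, lintegral_run_zero _ _ _ hfm, lintegral_run_zero _ _ _ hfm]
      refine (hg.select_le hg' (h.Glow_pos t ht (by omega)) (h.mul_Gup_le ht (by omega)) hε
        (Nat.succ_pos m) hi (c := K * w) (hfm.comp (by fun_prop)) fun x y => ?_).trans ?_
      · exact hf.zero _ _ fun j hj => absurd (Fin.ext (by simp)) hj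
      · rw [lipConst, add_mul, mul_assoc]
        exact add_le_add le_rfl le_self_add
    | succ n =>
      have htT' : t < T := by omega
      rw [truncatedRun, lintegral_step _ _ _ _ _ hfm, lintegral_step _ _ _ _ _ hfm]
      have hb' := 𝓜.measurable_integrateBackward_right t hfm g'
      have htame := tame_integrateBackward h (Nat.succ_pos m) ht htT' hg' hK hfm hf
      set κ := 𝓜.truncatedRun (m + 1) x₀ d n (t + 1) with hκ
      have h1 : ∀ z, 𝓜.integrateBackward t f g z ≤
          𝓜.integrateBackward t f g' z + ((ε : ℝ≥0∞) * (m + 1 : ℕ))⁻¹ * (K * w) := fun z =>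
        lintegral_backward_generation_le h hε (Nat.succ_pos m) ht htT' hg hg' hi _
          (measurable_cons_left hfm z) (Tame.cons_le hf z)
      calc _ ≤ ∫⁻ g₁, ∫⁻ z, 𝓜.integrateBackward t f g' z ∂κ (g₁, fun i => r i.succ)
              ∂𝓜.nextGeneration (m + 1) (t + 1) (g, r 0) +
              ((ε : ℝ≥0∞) * (m + 1 : ℕ))⁻¹ * (K * w) :=
            lintegral_le_add_of_le _ (nextGeneration_univ_le m _ _) (ae_of_all _ fun g₁ =>
              lintegral_le_add_of_le _ (truncatedRun_univ_le _ _ _ _ _)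
                (ae_of_all _ fun z => h1 z))
        _ ≤ ∫⁻ g₁, ∫⁻ z, 𝓜.integrateBackward t f g' z ∂κ (g₁, fun i => r i.succ)
              ∂𝓜.nextGeneration (m + 1) (t + 1) (g', r 0) +
              (1 + (ε : ℝ≥0∞)⁻¹) * (lipConst ε K a (m + 1) d * (w * a)) +
              ((ε : ℝ≥0∞) * (m + 1 : ℕ))⁻¹ * (K * w) := by
            gcongr
            exact lintegral_nextGeneration_le h hε ht htT' hg hg' hi _
              (hb'.lintegral_kernel.comp (measurable_id.prodMk measurable_const))
              fun k g₁ g₂ hg₁ hg₂ hk => ih (by omega) (by omega) hb' htame hg₁ hg₂ hk _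
        _ = _ := by rw [lipConst]; ring

/-- The error of the truncation. -/
lemma run_le_truncatedRun (h : 𝓜.StrongMixing T ε) {m : ℕ} (x₀ : X) {K a : ℝ≥0∞}
    (ha : a ≤ 1) (hK : a + ((1 - ε : ℝ≥0) : ℝ≥0∞) * K ≤ K * a) (d : ℕ) {n t : ℕ} (ht : 1 ≤ t)
    (htT : t + n ≤ T) {w : ℝ≥0∞} {f : (Fin (n + 1) → X) → ℝ≥0∞} (hfm : Measurable f)
    (hf : Tame K a w f) {g : Generation (m + 1) X} (hg : 𝓜.Good t g) (r : Fin n → X) :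
    ∫⁻ z, f z ∂𝓜.run (m + 1) n t (g, r) ≤
        ∫⁻ z, f z ∂𝓜.truncatedRun (m + 1) x₀ d n t (g, r) + a ^ d * (K + (1 - a)⁻¹) * w ∧
      ∫⁻ z, f z ∂𝓜.truncatedRun (m + 1) x₀ d n t (g, r) ≤
        ∫⁻ z, f z ∂𝓜.run (m + 1) n t (g, r) + a ^ d * (K + (1 - a)⁻¹) * w := by
  induction d generalizing n t g w with
  | zero =>
    have : IsProbabilityMeasure (𝓜.run (m + 1) n t (g, r)) := ⟨run_univ h ht htT hg r⟩
    have : IsProbabilityMeasure (𝓜.truncatedRun (m + 1) x₀ 0 n t (g, r)) := by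
      rw [truncatedRun, Kernel.const_apply]
      infer_instance
    -- At depth `0` the two output laws need not be related; the full oscillation of `f` is paid.
    rw [pow_zero, one_mul]
    exact ⟨lintegral_le_add_of_osc _ _ (hf.osc ha), lintegral_le_add_of_osc _ _ (hf.osc ha)⟩
  | succ d ih =>
    cases n with
    -- With no time step remaining, the truncation at positive depth is the algorithm itself.
    | zero => exact ⟨le_self_add, le_self_add⟩
    | succ n =>
      have htT' : t < T := by omega
      rw [truncatedRun, run_succ, lintegral_step _ _ _ _ _ hfm, lintegral_step _ _ _ _ _ hfm]
      have hb := 𝓜.measurable_integrateBackward_right t hfm g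
      have htame := tame_integrateBackward h (Nat.succ_pos m) ht htT' hg hK hfm hf
      have hae := ae_good_nextGeneration h ht htT' hg (r 0)
      -- Each level of recursion turns the weight `w` into `w a`; this is what produces `a ^ d`.
      have hw : a ^ (d + 1) * (K + (1 - a)⁻¹) * w = a ^ d * (K + (1 - a)⁻¹) * (w * a) := by ring
      rw [hw]
      constructor
      · refine lintegral_le_add_of_le _ (nextGeneration_univ_le m _ _) ?_
        filter_upwards [hae] with g₁ hg₁
        exact (ih (by omega) (by omega) hb htame hg₁ _).1
      · refine lintegral_le_add_of_le _ (nextGeneration_univ_le m _ _) ?_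
        filter_upwards [hae] with g₁ hg₁
        exact (ih (by omega) (by omega) hb htame hg₁ _).2

/-! ### Contraction -/

/-- The contraction factor obtained from truncation at depth `d`. -/
noncomputable def contractionFactor (ε K a : ℝ≥0∞) (N d : ℕ) : ℝ≥0∞ :=
  lipConst ε K a N d + 2 * (a ^ d * (K + (1 - a)⁻¹))

/-- Changing one particle of the current generation. -/
lemma run_generation_le (h : 𝓜.StrongMixing T ε) (hε : 0 < ε) {m : ℕ} {K a : ℝ≥0∞}
    (ha : a ≤ 1) (hK : a + ((1 - ε : ℝ≥0) : ℝ≥0∞) * K ≤ K * a) (d : ℕ) {n t : ℕ} (ht : 1 ≤ t)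
    (htT : t + n ≤ T) {w : ℝ≥0∞} {f : (Fin (n + 1) → X) → ℝ≥0∞} (hfm : Measurable f)
    (hf : Tame K a w f) {g g' : Generation (m + 1) X} (hg : 𝓜.Good t g) (hg' : 𝓜.Good t g')
    {i : Fin (m + 1)} (hi : ∀ j, j ≠ i → g j = g' j) (r : Fin n → X) :
    ∫⁻ z, f z ∂𝓜.run (m + 1) n t (g, r) ≤
      ∫⁻ z, f z ∂𝓜.run (m + 1) n t (g', r) + contractionFactor ε K a (m + 1) d * w := by
  obtain ⟨x₀⟩ := 𝓜.nonempty
  have h1 := (run_le_truncatedRun h x₀ ha hK d ht htT hfm hf hg r).1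
  have h2 := truncatedRun_le h hε x₀ hK d ht htT hfm hf hg hg' hi r
  have h3 := (run_le_truncatedRun h x₀ ha hK d ht htT hfm hf hg' r).2
  refine (h1.trans (add_le_add_left (h2.trans (add_le_add_left h3 _)) _)).trans (le_of_eq ?_)
  rw [contractionFactor]
  ring

/-- Changing one state of the remaining reference trajectory. -/
lemma run_reference_le (h : 𝓜.StrongMixing T ε) (hε : 0 < ε) {m : ℕ} {K a : ℝ≥0∞}
    (ha : a ≤ 1) (hK : a + ((1 - ε : ℝ≥0) : ℝ≥0∞) * K ≤ K * a) (d : ℕ) {n t : ℕ} (ht : 1 ≤ t)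
    (htT : t + n ≤ T) {w : ℝ≥0∞} {f : (Fin (n + 1) → X) → ℝ≥0∞} (hfm : Measurable f)
    (hf : Tame K a w f) {g : Generation (m + 1) X} (hg : 𝓜.Good t g)
    (j : Fin n) {r r' : Fin n → X} (hr : ∀ i, i ≠ j → r i = r' i) :
    ∫⁻ z, f z ∂𝓜.run (m + 1) n t (g, r) ≤ ∫⁻ z, f z ∂𝓜.run (m + 1) n t (g, r') +
      contractionFactor ε K a (m + 1) d * (w * a ^ (j + 1 : ℕ)) := by
  induction n generalizing t g w with
  | zero => exact j.elim0
  | succ n ih =>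
    have htT' : t < T := by omega
    rw [run_succ, lintegral_step _ _ _ _ _ hfm, lintegral_step _ _ _ _ _ hfm]
    have hb := 𝓜.measurable_integrateBackward_right t hfm g
    have htame := tame_integrateBackward h (Nat.succ_pos m) ht htT' hg hK hfm hf
    have hae := ae_good_nextGeneration h ht htT' hg
    induction j using Fin.cases with
    | zero =>
      -- The trajectories agree after the next time step, so only the law of the next reference
      -- particle differs, and the influence of a single particle applies with weight `w a`.
      have htail : (fun i : Fin n => r i.succ) = fun i => r' i.succ :=
        funext fun i => hr _ (Fin.succ_ne_zero i)
      rw [htail]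
      refine (lintegral_nextGeneration_ref_le h ht htT' hg (r 0) (r' 0)
        (hb.lintegral_kernel.comp (measurable_id.prodMk measurable_const))
        fun k g₁ g₂ hg₁ hg₂ hk => run_generation_le h hε ha hK d (by omega) (by omega) hb htame
          hg₁ hg₂ hk _).trans (le_of_eq ?_)
      simp
    | succ j =>
      -- The next generation has the same law on both sides; moving one step ahead replaces `w` by
      -- `w a` and lowers the index of the changed state by one.
      rw [hr 0 (Fin.succ_ne_zero j).symm]
      refine lintegral_le_add_of_le _ (nextGeneration_univ_le m _ _) ?_
      filter_upwards [hae (r' 0)] with g₁ hg₁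
      refine (ih (by omega) (by omega) hb htame hg₁ j (r := fun i => r i.succ)
        (r' := fun i => r' i.succ)
        fun i hi => hr _ fun h => hi (Fin.succ_injective _ h)).trans (le_of_eq ?_)
      rw [Fin.val_succ]
      ring

/-- One iteration contracts coordinatewise oscillations. -/
lemma cbpf_le (h : 𝓜.StrongMixing T ε) (hε : 0 < ε) (hT : 1 ≤ T) {m : ℕ} {K a : ℝ≥0∞}
    (ha : a ≤ 1) (hK1 : 1 ≤ K)
    (hK : a + ((1 - ε : ℝ≥0) : ℝ≥0∞) * K ≤ K * a) (d : ℕ) {w : ℝ≥0∞}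
    {f : (Fin T → X) → ℝ≥0∞} (hfm : Measurable f)
    (hf : ∀ (i : Fin T) x y, (∀ j, j ≠ i → x j = y j) → f x ≤ f y + w * a ^ (i : ℕ))
    (i : Fin T) {x y : Fin T → X} (hxy : ∀ j, j ≠ i → x j = y j) :
    ∫⁻ z, f z ∂𝓜.cbpf (m + 1) T x ≤ ∫⁻ z, f z ∂𝓜.cbpf (m + 1) T y +
      contractionFactor ε K a (m + 1) d * w * a ^ (i : ℕ) := by
  obtain ⟨n, rfl⟩ : ∃ n, T = n + 1 := ⟨T - 1, by omega⟩
  -- The input has oscillation `w` in the first coordinate; it is relaxed to `K w`, using `1 ≤ K`.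
  -- The conclusion is again free of `K`, so the bound can be iterated.
  have htame : Tame K a w f := by
    refine ⟨fun x y hxy => (hf 0 x y hxy).trans ?_, fun j x y hxy => ?_⟩
    · exact add_le_add le_rfl (by simpa using le_mul_of_one_le_left' hK1)
    · simpa using hf j.succ x y hxy
  rw [lintegral_cbpf_succ _ _ _ hfm, lintegral_cbpf_succ _ _ _ hfm]
  induction i using Fin.cases with
  | zero =>
    have htail : (fun i : Fin n => x i.succ) = fun i => y i.succ :=
      funext fun i => hxy _ (Fin.succ_ne_zero i)
    rw [htail, Fin.val_zero, pow_zero, mul_one]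
    exact lintegral_initGeneration_le h hT (x 0) (y 0)
      (hfm.lintegral_kernel.comp (measurable_id.prodMk measurable_const))
      fun k g₁ g₂ hg₁ hg₂ hk => run_generation_le h hε ha hK d le_rfl (by omega) hfm htame
        hg₁ hg₂ hk _
  | succ j =>
    rw [hxy 0 (Fin.succ_ne_zero j).symm]
    refine lintegral_le_add_of_le _ (by simp) ?_
    filter_upwards [ae_good_initGeneration h m (y 0)] with g₁ hg₁
    refine (run_reference_le h hε ha hK d le_rfl (by omega) hfm htame hg₁ j
      (r := fun i => x i.succ) (r' := fun i => y i.succ)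
      fun i hi => hxy _ fun h => hi (Fin.succ_injective _ h)).trans (le_of_eq ?_)
    rw [Fin.val_succ, mul_assoc]

lemma isMarkovKernel_cbpf (h : 𝓜.StrongMixing T ε) (hT : 1 ≤ T) (m : ℕ) :
    IsMarkovKernel (𝓜.cbpf (m + 1) T) := by
  obtain ⟨n, rfl⟩ : ∃ n, T = n + 1 := ⟨T - 1, by omega⟩
  refine ⟨fun x => ⟨?_⟩⟩
  rw [← lintegral_one, lintegral_cbpf_succ _ _ _ measurable_const]
  have : ∀ᵐ g' ∂𝓜.initGeneration (m + 1) (x 0),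
      ∫⁻ _, 1 ∂𝓜.run (m + 1) n 1 (g', fun i => x i.succ) = 1 := by
    filter_upwards [ae_good_initGeneration h m (x 0)] with g' hg'
    rw [lintegral_one]
    exact run_univ h le_rfl (by omega) hg' _
  rw [lintegral_congr_ae this, lintegral_one, measure_univ]

end Model

/-! ### Exchangeability -/

/-- Multiplying by the total weight removes the normalisation; the identity then persists when all
weights vanish. -/
lemma mul_lintegral_select {N : ℕ} {X : Type*} [MeasurableSpace X] (g : Generation N X)
    {φ : X → ℝ≥0∞} (hφ : Measurable φ) :
    (∑ j, ((g j).2 : ℝ≥0∞)) * ∫⁻ x, φ x ∂select N X g = ∑ i, ((g i).2 : ℝ≥0∞) * φ (g i).1 := by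
  rw [lintegral_select g hφ, Finset.mul_sum]
  refine Finset.sum_congr rfl fun i _ => ?_
  rw [← mul_assoc]
  congr 1
  refine ENNReal.mul_div_cancel' (fun h0 => ?_) fun h => absurd h (sum_weights_ne_top g)
  exact (Finset.sum_eq_zero_iff.1 h0) i (Finset.mem_univ i)

lemma select_comp_perm {N : ℕ} {X : Type*} [MeasurableSpace X] (g : Generation N X)
    (σ : Equiv.Perm (Fin N)) : select N X (g ∘ σ) = select N X g := by
  refine Measure.ext_of_lintegral _ fun φ hφ => ?_
  rw [lintegral_select _ hφ, lintegral_select _ hφ]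
  simp only [Function.comp_apply]
  rw [Equiv.sum_comp σ fun j => ((g j).2 : ℝ≥0∞)]
  exact Equiv.sum_comp σ fun i => ((g i).2 : ℝ≥0∞) / (∑ j, ((g j).2 : ℝ≥0∞)) * φ (g i).1

lemma lintegral_pi_comp_perm {E : Type*} [MeasurableSpace E] {N : ℕ} (ν : Measure E)
    [SigmaFinite ν] (σ : Equiv.Perm (Fin N)) {Q : (Fin N → E) → ℝ≥0∞} (hQ : Measurable Q) :
    ∫⁻ g, Q (g ∘ σ) ∂(Measure.pi fun _ : Fin N => ν) =
      ∫⁻ g, Q g ∂(Measure.pi fun _ : Fin N => ν) := by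
  have h := measurePreserving_piCongrLeft (fun _ : Fin N => ν) σ.symm
  rw [← h.lintegral_comp hQ]
  refine lintegral_congr fun g => ?_
  congr 1
  funext i
  obtain ⟨j, rfl⟩ := σ.symm.surjective i
  simp [MeasurableEquiv.piCongrLeft, Equiv.piCongrLeft_apply_apply]

/-- An i.i.d. law is invariant under each transposition, so `m + 1` times either integral is the
integral of the symmetrised sum. -/
lemma lintegral_pi_eq_of_symmetrized {E : Type*} [MeasurableSpace E] {m : ℕ} (ν : Measure E)
    [IsProbabilityMeasure ν] {Q : (Fin (m + 1) → E) → ℝ≥0∞} (hQ : Measurable Q) {C : E → ℝ≥0∞}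
    (hC : Measurable C) (h : ∀ g, ∑ i, Q (g ∘ Equiv.swap 0 i) = ∑ i, C (g i)) :
    ∫⁻ g, Q g ∂(Measure.pi fun _ : Fin (m + 1) => ν) = ∫⁻ a, C a ∂ν := by
  have hQσ : ∀ i : Fin (m + 1), Measurable fun g : Fin (m + 1) → E => Q (g ∘ Equiv.swap 0 i) :=
    fun i => hQ.comp (measurable_pi_lambda _ fun j => measurable_pi_apply _)
  have hCi : ∀ i : Fin (m + 1), Measurable fun g : Fin (m + 1) → E => C (g i) :=
    fun i => hC.comp (measurable_pi_apply i)
  have key : ((m + 1 : ℕ) : ℝ≥0∞) * ∫⁻ g, Q g ∂(Measure.pi fun _ : Fin (m + 1) => ν) =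
      ((m + 1 : ℕ) : ℝ≥0∞) * ∫⁻ a, C a ∂ν :=
    calc _ = ∑ i : Fin (m + 1),
          ∫⁻ g, Q (g ∘ Equiv.swap 0 i) ∂(Measure.pi fun _ : Fin (m + 1) => ν) := by
          simp [lintegral_pi_comp_perm ν _ hQ]
      _ = ∑ i : Fin (m + 1), ∫⁻ g, C (g i) ∂(Measure.pi fun _ : Fin (m + 1) => ν) := by
          rw [← lintegral_finsetSum _ fun i _ => hQσ i,
            ← lintegral_finsetSum _ fun i _ => hCi i]
          exact lintegral_congr h
      _ = _ := by
          have : ∀ i : Fin (m + 1), ∫⁻ g, C (g i) ∂(Measure.pi fun _ : Fin (m + 1) => ν) =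
              ∫⁻ a, C a ∂ν := fun i =>
            (measurePreserving_eval (fun _ : Fin (m + 1) => ν) i).lintegral_comp hC
          simp [this]
  exact (ENNReal.mul_right_inj (by simp) (ENNReal.natCast_ne_top _)).1 key

/-- Integrating a particle system in which the particle `0` is size-biased by its weight, together
with a trajectory that starts from it. -/
lemma lintegral_sizeBiased {X : Type*} [MeasurableSpace X] {m n : ℕ} {μ : Measure X}
    [SigmaFinite μ] (ν : Measure (X × ℝ≥0)) [IsProbabilityMeasure ν]
    {pw : X → (Fin n → X) → ℝ≥0∞} (hpw : Measurable (Function.uncurry pw))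
    {Φ : Generation (m + 1) X → (Fin n → X) → ℝ≥0∞} (hΦ : Measurable (Function.uncurry Φ))
    {H : (Fin (n + 1) → X) → ℝ≥0∞} (hH : Measurable H)
    (h : ∀ g : Generation (m + 1) X,
      ∑ i, ((g i).2 : ℝ≥0∞) * ∫⁻ r, pw (g i).1 r * Φ (g ∘ Equiv.swap 0 i) r
          ∂(Measure.pi fun _ : Fin n => μ) =
        ∑ i, ((g i).2 : ℝ≥0∞) * ∫⁻ r, pw (g i).1 r * H (Fin.cons (g i).1 r)
          ∂(Measure.pi fun _ : Fin n => μ)) :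
    ∫⁻ a, (a.2 : ℝ≥0∞) * ∫⁻ r, pw a.1 r * ∫⁻ g, Φ (Fin.cons a g) r
        ∂(Measure.pi fun _ : Fin m => ν) ∂(Measure.pi fun _ : Fin n => μ) ∂ν =
      ∫⁻ a, (a.2 : ℝ≥0∞) * ∫⁻ r, pw a.1 r * H (Fin.cons a.1 r)
        ∂(Measure.pi fun _ : Fin n => μ) ∂ν := by
  have hpwr : ∀ x, Measurable (pw x) := fun x => hpw.comp (measurable_const.prodMk measurable_id)
  have hw : Measurable fun a : X × ℝ≥0 => (a.2 : ℝ≥0∞) := measurable_snd.coe_nnreal_ennreal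
  have hQr : Measurable fun p : Generation (m + 1) X × (Fin n → X) =>
      pw (p.1 0).1 p.2 * Φ p.1 p.2 :=
    (hpw.comp (by fun_prop : Measurable fun p : Generation (m + 1) X × (Fin n → X) =>
      ((p.1 0).1, p.2))).mul hΦ
  -- The integrand to be symmetrised: the bias is by the weight of particle `0`, and swapping `0`
  -- with `i` yields the `i`-th summand on the left of `h`.
  have hQ : Measurable fun g : Generation (m + 1) X => ((g 0).2 : ℝ≥0∞) *
      ∫⁻ r, pw (g 0).1 r * Φ g r ∂(Measure.pi fun _ : Fin n => μ) :=
    (hw.comp (measurable_pi_apply 0)).mul hQr.lintegral_prod_right'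
  have hC : Measurable fun a : X × ℝ≥0 => (a.2 : ℝ≥0∞) *
      ∫⁻ r, pw a.1 r * H (Fin.cons a.1 r) ∂(Measure.pi fun _ : Fin n => μ) := by
    refine hw.mul (Measurable.lintegral_prod_right' (f := fun p : (X × ℝ≥0) × (Fin n → X) =>
      pw p.1.1 p.2 * H (Fin.cons p.1.1 p.2)) ?_)
    have : Measurable fun p : (X × ℝ≥0) × (Fin n → X) => (p.1.1, p.2) := by fun_prop
    exact (hpw.comp this).mul (hH.comp (measurable_cons.comp this))
  rw [← lintegral_pi_eq_of_symmetrized ν hQ hC fun g => by simpa using h g,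
    lintegral_pi_cons _ hQ]
  refine lintegral_congr fun a => ?_
  simp only [Fin.cons_zero]
  have hΦa : Measurable fun p : (Fin n → X) × (Fin m → X × ℝ≥0) => Φ (Fin.cons a p.2) p.1 :=
    hΦ.comp ((measurable_cons.comp (measurable_const.prodMk measurable_snd)).prodMk measurable_fst)
  have hpΦ : Measurable fun p : (Fin n → X) × (Fin m → X × ℝ≥0) =>
      pw a.1 p.1 * Φ (Fin.cons a p.2) p.1 := ((hpwr a.1).comp measurable_fst).mul hΦa
  have hpΦr : Measurable fun g => ∫⁻ r, pw a.1 r * Φ (Fin.cons a g) r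
      ∂(Measure.pi fun _ : Fin n => μ) := (hpΦ.comp measurable_swap).lintegral_prod_right'
  rw [lintegral_const_mul _ hpΦr,
    lintegral_lintegral_swap (f := fun g r => pw a.1 r * Φ (Fin.cons a g) r)
      (hpΦ.comp measurable_swap).aemeasurable]
  congr 1
  refine lintegral_congr fun r => ?_
  exact (lintegral_const_mul _ (hΦa.comp (measurable_const.prodMk measurable_id))).symm

namespace Model

variable {X : Type*} [MeasurableSpace X] {μ : Measure X}

/-! ### The density of the future trajectory -/

/-- The unnormalised density of the states at the times `t + 1, …, t + n` given the state `x` at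
time `t`. -/
noncomputable def pathWeight (𝓜 : Model X μ) : (n t : ℕ) → X → (Fin n → X) → ℝ≥0∞
  | 0, _, _, _ => 1
  | n + 1, t, x, r => (𝓜.M (t + 1) x (r 0) : ℝ≥0∞) * 𝓜.G (t + 1) x (r 0) *
      pathWeight 𝓜 n (t + 1) (r 0) fun i => r i.succ

lemma measurable_pathWeight (𝓜 : Model X μ) (n t : ℕ) :
    Measurable (Function.uncurry (𝓜.pathWeight n t)) := by
  induction n generalizing t with
  | zero => exact measurable_const
  | succ n ih =>
    have h0 : Measurable fun p : X × (Fin (n + 1) → X) => (p.1, p.2 0) := by fun_prop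
    have h1 : Measurable fun p : X × (Fin (n + 1) → X) => (p.2 0, fun i : Fin n => p.2 i.succ) := by
      fun_prop
    exact (((𝓜.measurable_M (t + 1)).comp h0).coe_nnreal_ennreal.mul
      ((𝓜.measurable_G (t + 1)).comp h0).coe_nnreal_ennreal).mul ((ih (t + 1)).comp h1)

lemma pathWeight_eq_prod (𝓜 : Model X μ) (n t : ℕ) (x : X) (r : Fin n → X) :
    𝓜.pathWeight n t x r = ((∏ i : Fin n,
      𝓜.M (i + (t + 1)) ((Fin.cons x r : Fin (n + 1) → X) i.castSucc) (r i) *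
      𝓜.G (i + (t + 1)) ((Fin.cons x r : Fin (n + 1) → X) i.castSucc) (r i) : ℝ≥0) : ℝ≥0∞) := by
  induction n generalizing t x with
  | zero => simp [pathWeight]
  | succ n ih =>
    rw [pathWeight, ih, Fin.prod_univ_succ]
    push_cast
    congr 1
    · simp
    · refine Finset.prod_congr rfl fun i _ => ?_
      have hc : (Fin.cons (r 0) fun i : Fin n => r i.succ : Fin (n + 1) → X) = r :=
        Fin.cons_self_tail r
      rw [hc, ← Fin.succ_castSucc, Fin.cons_succ, Fin.val_succ]
      congr 3 <;> ring

lemma gamma_succ (𝓜 : Model X μ) (n : ℕ) (x : X) (r : Fin n → X) :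
    (𝓜.gamma (n + 1) (Fin.cons x r) : ℝ≥0∞) =
      (𝓜.M₁ x : ℝ≥0∞) * 𝓜.G₁ x * 𝓜.pathWeight n 1 x r := by
  rw [pathWeight_eq_prod, gamma]
  push_cast
  simp

lemma measurable_gamma (𝓜 : Model X μ) (n : ℕ) :
    Measurable fun x => (𝓜.gamma (n + 1) x : ℝ≥0∞) := by
  have h : ∀ x : Fin (n + 1) → X, (𝓜.gamma (n + 1) x : ℝ≥0∞) =
      (𝓜.M₁ (x 0) : ℝ≥0∞) * 𝓜.G₁ (x 0) * 𝓜.pathWeight n 1 (x 0) (fun i => x i.succ) := by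
    intro x
    rw [← gamma_succ]
    congr 2
    exact (Fin.cons_self_tail x).symm
  simp only [h]
  have h1 : Measurable fun p : Fin (n + 1) → X => (p 0, fun i : Fin n => p i.succ) := by fun_prop
  exact ((𝓜.measurable_M₁.comp (measurable_pi_apply 0)).coe_nnreal_ennreal.mul
    (𝓜.measurable_G₁.comp (measurable_pi_apply 0)).coe_nnreal_ennreal).mul
    ((𝓜.measurable_pathWeight n 1).comp h1)

lemma integrateBackward_comp_perm (𝓜 : Model X μ) {N n : ℕ} (t : ℕ) (g : Generation N X)
    (σ : Equiv.Perm (Fin N)) (f : (Fin (n + 2) → X) → ℝ≥0∞) :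
    𝓜.integrateBackward t f (g ∘ σ) = 𝓜.integrateBackward t f g := by
  funext z
  rw [integrateBackward, integrateBackward, lintegral_backward, lintegral_backward]
  exact congrArg (fun ν => ∫⁻ x, f (Fin.cons x z) ∂ν)
    (select_comp_perm (𝓜.backwardWeigh t (g, z 0)) σ)

lemma lintegral_initGeneration (𝓜 : Model X μ) {m : ℕ} (x : X)
    {F : Generation (m + 1) X → ℝ≥0∞} (hF : Measurable F) :
    ∫⁻ g', F g' ∂𝓜.initGeneration (m + 1) x =
      ∫⁻ g', F (Fin.cons (x, 𝓜.G₁ x) g')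
        ∂(Measure.pi fun _ : Fin m => 𝓜.initLaw.map 𝓜.weigh₁) := by
  have : IsProbabilityMeasure (𝓜.initLaw.map 𝓜.weigh₁) :=
    Measure.isProbabilityMeasure_map 𝓜.measurable_weigh₁.aemeasurable
  rw [initGeneration_apply, lintegral_pi_cons _ hF]
  simp only [initParticle_succ]
  rw [initParticle_zero, lintegral_dirac']
  · rfl
  · exact (hF.comp measurable_cons).lintegral_prod_right'

variable [SigmaFinite μ]

lemma freeParticle_comp_perm (𝓜 : Model X μ) {N : ℕ} (t : ℕ) (g : Generation N X)
    (σ : Equiv.Perm (Fin N)) : 𝓜.freeParticle t (g ∘ σ) = 𝓜.freeParticle t g := by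
  refine Measure.ext_of_lintegral _ fun φ hφ => ?_
  rw [lintegral_freeParticle _ _ _ hφ, lintegral_freeParticle _ _ _ hφ, select_comp_perm]

lemma lintegral_nextGeneration (𝓜 : Model X μ) {m : ℕ} (t : ℕ) (g : Generation (m + 1) X) (y : X)
    {F : Generation (m + 1) X → ℝ≥0∞} (hF : Measurable F) :
    ∫⁻ g', F g' ∂𝓜.nextGeneration (m + 1) t (g, y) =
      ∫⁻ g', F (Fin.cons (y, 𝓜.G t (g 0).1 y) g')
        ∂(Measure.pi fun _ : Fin m => 𝓜.freeParticle t g) := by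
  rw [nextGeneration_apply, lintegral_pi_cons _ hF]
  simp only [nextParticle_succ]
  rw [nextParticle_zero, lintegral_dirac']
  · rfl
  · have : IsFiniteMeasure (𝓜.freeParticle t g) :=
      ⟨by rw [freeParticle_univ]; exact measure_lt_top _ _⟩
    exact (hF.comp measurable_cons).lintegral_prod_right'

/-- A weighted integral against the law of a new particle. -/
lemma mul_lintegral_freeParticle (𝓜 : Model X μ) {N : ℕ} (t : ℕ) (g : Generation N X)
    {B : X × ℝ≥0 → ℝ≥0∞} (hB : Measurable B) :
    (∑ j, ((g j).2 : ℝ≥0∞)) * ∫⁻ a, (a.2 : ℝ≥0∞) * B a ∂𝓜.freeParticle t g =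
      ∑ i, ((g i).2 : ℝ≥0∞) * ∫⁻ y, (𝓜.M t (g i).1 y : ℝ≥0∞) * 𝓜.G t (g i).1 y *
        B (y, 𝓜.G t (g i).1 y) ∂μ := by
  have hwB : Measurable fun a : X × ℝ≥0 => (a.2 : ℝ≥0∞) * B a :=
    measurable_snd.coe_nnreal_ennreal.mul hB
  rw [lintegral_freeParticle _ _ _ hwB, mul_lintegral_select g (𝓜.measurable_lintegral_trans t hwB)]
  refine Finset.sum_congr rfl fun i _ => ?_
  rw [lintegral_trans]
  · simp only [mul_assoc]
  · exact hwB.comp ((𝓜.measurable_weigh t).comp (measurable_const.prodMk measurable_id))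

/-- Given the generation at time `t`, the algorithm leaves invariant the law of a trajectory
which starts from a particle chosen according to the weights, provided that this particle is the
reference particle. -/
theorem sum_lintegral_run (𝓜 : Model X μ) {m : ℕ} (n t : ℕ) (g : Generation (m + 1) X)
    {f : (Fin (n + 1) → X) → ℝ≥0∞} (hf : Measurable f) :
    ∑ i, ((g i).2 : ℝ≥0∞) * ∫⁻ r, 𝓜.pathWeight n t (g i).1 r *
        ∫⁻ z, f z ∂𝓜.run (m + 1) n t (g ∘ Equiv.swap 0 i, r) ∂(Measure.pi fun _ : Fin n => μ) =
      ∑ i, ((g i).2 : ℝ≥0∞) * ∫⁻ r, 𝓜.pathWeight n t (g i).1 r * f (Fin.cons (g i).1 r)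
        ∂(Measure.pi fun _ : Fin n => μ) := by
  induction n generalizing t g with
  | zero =>
    have hfx : Measurable fun x : X => f fun _ => x := hf.comp (by fun_prop)
    have hd : (Measure.pi fun _ : Fin 0 => μ) = Measure.dirac isEmptyElim :=
      Measure.pi_of_empty _ _
    simp only [hd, lintegral_dirac, pathWeight, one_mul, lintegral_run_zero _ _ _ hf,
      select_comp_perm]
    rw [← Finset.sum_mul, mul_lintegral_select g hfx]
    refine Finset.sum_congr rfl fun i _ => ?_
    congr 2
    funext j
    rw [Fin.eq_zero j, Fin.cons_zero]
  | succ n ih =>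
    -- If all weights vanish both sides are zero; otherwise the law of a new particle is a
    -- probability.
    by_cases hW : ∑ j, ((g j).2 : ℝ≥0∞) = 0
    · rw [Finset.sum_eq_zero_iff] at hW
      simp [hW]
    set ν := 𝓜.freeParticle (t + 1) g with hν
    have : IsProbabilityMeasure ν := ⟨by
      rw [hν, freeParticle_univ, ← lintegral_one, lintegral_select _ measurable_const]
      simp only [mul_one, div_eq_mul_inv, ← Finset.sum_mul]
      exact ENNReal.mul_inv_cancel hW (sum_weights_ne_top g)⟩
    set h := 𝓜.integrateBackward t f g with hh
    have hhm : Measurable h := 𝓜.measurable_integrateBackward_right t hf g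
    set pw := 𝓜.pathWeight n (t + 1) with hpw
    have hpwm : Measurable (Function.uncurry pw) := 𝓜.measurable_pathWeight n (t + 1)
    have hpwr : ∀ x, Measurable (pw x) := fun x =>
      hpwm.comp (measurable_const.prodMk measurable_id)
    set Φ : Generation (m + 1) X → (Fin n → X) → ℝ≥0∞ := fun g' r =>
      ∫⁻ z, h z ∂𝓜.run (m + 1) n (t + 1) (g', r) with hΦ
    have hΦm : Measurable (Function.uncurry Φ) := hhm.lintegral_kernel
    have hMG : ∀ i, Measurable fun y => (𝓜.M (t + 1) (g i).1 y : ℝ≥0∞) * 𝓜.G (t + 1) (g i).1 y :=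
      fun i => ((𝓜.measurable_M (t + 1)).comp
        (measurable_const.prodMk measurable_id)).coe_nnreal_ennreal.mul
        ((𝓜.measurable_G (t + 1)).comp (measurable_const.prodMk measurable_id)).coe_nnreal_ennreal
    have hB : Measurable fun a : X × ℝ≥0 => ∫⁻ r, pw a.1 r * ∫⁻ g', Φ (Fin.cons a g') r
        ∂(Measure.pi fun _ : Fin m => ν) ∂(Measure.pi fun _ : Fin n => μ) := by
      refine Measurable.lintegral_prod_right' (f := fun p : (X × ℝ≥0) × (Fin n → X) =>
        pw p.1.1 p.2 * ∫⁻ g', Φ (Fin.cons p.1 g') p.2 ∂(Measure.pi fun _ : Fin m => ν)) ?_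
      refine Measurable.mul (hpwm.comp (by fun_prop :
        Measurable fun p : (X × ℝ≥0) × (Fin n → X) => (p.1.1, p.2))) ?_
      refine Measurable.lintegral_prod_right'
        (f := fun q : ((X × ℝ≥0) × (Fin n → X)) × (Fin m → X × ℝ≥0) =>
          Φ (Fin.cons q.1.1 q.2) q.1.2) ?_
      exact hΦm.comp ((measurable_cons.comp
        ((measurable_fst.comp measurable_fst).prodMk measurable_snd)).prodMk
        (measurable_snd.comp measurable_fst))
    have hpwh : Measurable fun p : X × (Fin n → X) => pw p.1 p.2 * h (Fin.cons p.1 p.2) :=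
      hpwm.mul (hhm.comp measurable_cons)
    have hC : Measurable fun a : X × ℝ≥0 => ∫⁻ r, pw a.1 r * h (Fin.cons a.1 r)
        ∂(Measure.pi fun _ : Fin n => μ) :=
      hpwh.lintegral_prod_right'.comp measurable_fst
    -- The induction hypothesis is applied to `h`, that is, to `f` with backward sampling at time
    -- `t` already integrated out, and averaged over the new generation.
    have hsize := lintegral_sizeBiased (μ := μ) ν hpwm hΦm hhm fun g' => ih (t + 1) g' hhm
    -- integrating out the new generation
    have hleft : ∀ i, ∫⁻ r, 𝓜.pathWeight (n + 1) t (g i).1 r *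
          ∫⁻ z, f z ∂𝓜.run (m + 1) (n + 1) t (g ∘ Equiv.swap 0 i, r)
            ∂(Measure.pi fun _ : Fin (n + 1) => μ) =
        ∫⁻ y, (𝓜.M (t + 1) (g i).1 y : ℝ≥0∞) * 𝓜.G (t + 1) (g i).1 y *
          ∫⁻ r, pw y r * ∫⁻ g', Φ (Fin.cons (y, 𝓜.G (t + 1) (g i).1 y) g') r
            ∂(Measure.pi fun _ : Fin m => ν) ∂(Measure.pi fun _ : Fin n => μ) ∂μ := by
      intro i
      have hm0 : Measurable fun r : Fin (n + 1) → X => 𝓜.pathWeight (n + 1) t (g i).1 r *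
          ∫⁻ z, f z ∂𝓜.run (m + 1) (n + 1) t (g ∘ Equiv.swap 0 i, r) :=
        ((𝓜.measurable_pathWeight (n + 1) t).comp (measurable_const.prodMk measurable_id)).mul
          (hf.lintegral_kernel.comp (measurable_const.prodMk measurable_id))
      rw [lintegral_pi_cons _ hm0]
      refine lintegral_congr fun y => ?_
      have hinner : ∀ r : Fin n → X,
          ∫⁻ z, f z ∂𝓜.run (m + 1) (n + 1) t (g ∘ Equiv.swap 0 i, Fin.cons y r) =
          ∫⁻ g', Φ (Fin.cons (y, 𝓜.G (t + 1) (g i).1 y) g') r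
            ∂(Measure.pi fun _ : Fin m => ν) := by
        intro r
        rw [run_succ, lintegral_step _ _ _ _ _ hf, integrateBackward_comp_perm]
        simp only [Fin.cons_zero, Fin.cons_succ]
        have hΦr : Measurable fun g' => Φ g' r :=
          hΦm.comp (measurable_id.prodMk measurable_const)
        change ∫⁻ g', Φ g' r ∂_ = _
        rw [lintegral_nextGeneration _ _ _ _ hΦr, freeParticle_comp_perm]
        simp [hν]
      have hD : Measurable fun r : Fin n → X => pw y r *
          ∫⁻ g', Φ (Fin.cons (y, 𝓜.G (t + 1) (g i).1 y) g') r
            ∂(Measure.pi fun _ : Fin m => ν) := by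
        refine (hpwr y).mul (Measurable.lintegral_prod_right'
          (f := fun q : (Fin n → X) × (Fin m → X × ℝ≥0) =>
            Φ (Fin.cons (y, 𝓜.G (t + 1) (g i).1 y) q.2) q.1) ?_)
        exact hΦm.comp ((measurable_cons.comp
          (measurable_const.prodMk measurable_snd)).prodMk measurable_fst)
      rw [← lintegral_const_mul _ hD]
      simp only [hinner, pathWeight, Fin.cons_zero, Fin.cons_succ, mul_assoc, hpw]
    have hright : ∀ i, ∫⁻ r, 𝓜.pathWeight (n + 1) t (g i).1 r * f (Fin.cons (g i).1 r)
          ∂(Measure.pi fun _ : Fin (n + 1) => μ) =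
        ∫⁻ y, ∫⁻ r, (𝓜.M (t + 1) (g i).1 y : ℝ≥0∞) * 𝓜.G (t + 1) (g i).1 y * (pw y r *
          f (Fin.cons (g i).1 (Fin.cons y r))) ∂(Measure.pi fun _ : Fin n => μ) ∂μ := by
      intro i
      rw [lintegral_pi_cons]
      · simp only [pathWeight, Fin.cons_zero, Fin.cons_succ, mul_assoc, hpw]
      · exact ((𝓜.measurable_pathWeight (n + 1) t).comp
          (measurable_const.prodMk measurable_id)).mul
          (hf.comp (measurable_cons.comp (measurable_const.prodMk measurable_id)))
    have hfc : ∀ i, Measurable fun p : X × (Fin n → X) =>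
        (𝓜.M (t + 1) (g i).1 p.1 : ℝ≥0∞) * 𝓜.G (t + 1) (g i).1 p.1 * (pw p.1 p.2 *
          f (Fin.cons (g i).1 (Fin.cons p.1 p.2))) := fun i =>
      ((hMG i).comp measurable_fst).mul (hpwm.mul (hf.comp (measurable_cons.comp
        (measurable_const.prodMk measurable_cons))))
    simp only [hleft, hright]
    -- Choosing a parent by weight and then moving with density `M G` is drawing a free particle
    -- biased by its own weight. The identity is used backwards to reach the size-biased form, then
    -- forwards to return.
    rw [← mul_lintegral_freeParticle 𝓜 (t + 1) g hB, hsize,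
      mul_lintegral_freeParticle 𝓜 (t + 1) g hC]
    have hL : ∀ i, Measurable fun y =>
        (𝓜.M (t + 1) (g i).1 y : ℝ≥0∞) * 𝓜.G (t + 1) (g i).1 y *
          ∫⁻ r, pw y r * h (Fin.cons y r) ∂(Measure.pi fun _ : Fin n => μ) := fun i =>
      (hMG i).mul hpwh.lintegral_prod_right'
    have hR : ∀ i, Measurable fun y =>
        ∫⁻ r, (𝓜.M (t + 1) (g i).1 y : ℝ≥0∞) * 𝓜.G (t + 1) (g i).1 y * (pw y r *
          f (Fin.cons (g i).1 (Fin.cons y r))) ∂(Measure.pi fun _ : Fin n => μ) := fun i =>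
      (hfc i).lintegral_prod_right'
    simp only [← lintegral_const_mul _ (hL _), ← lintegral_const_mul _ (hR _)]
    rw [← lintegral_finsetSum _ fun i _ => (hL i).const_mul _,
      ← lintegral_finsetSum _ fun i _ => (hR i).const_mul _]
    refine lintegral_congr fun y => ?_
    have hpwhy : Measurable fun r => pw y r * h (Fin.cons y r) :=
      hpwh.comp (measurable_const.prodMk measurable_id)
    have hfcy : ∀ i, Measurable fun r =>
        (𝓜.M (t + 1) (g i).1 y : ℝ≥0∞) * 𝓜.G (t + 1) (g i).1 y * (pw y r *
          f (Fin.cons (g i).1 (Fin.cons y r))) := fun i =>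
      (hfc i).comp (measurable_const.prodMk measurable_id)
    simp only [← lintegral_const_mul _ hpwhy, ← lintegral_const_mul _ (hfcy _),
      ← lintegral_const_mul _ (hpwhy.const_mul _)]
    rw [← lintegral_finsetSum _ fun i _ => (hpwhy.const_mul _).const_mul _,
      ← lintegral_finsetSum _ fun i _ => (hfcy i).const_mul _]
    refine lintegral_congr fun r => ?_
    -- For fixed `y` and `r`, the remaining sum of `ω M G` is the normalising constant of backward
    -- sampling, so it cancels and leaves `f` evaluated at each particle with its backward weight.
    have hsel := mul_lintegral_select (𝓜.backwardWeigh t (g, y))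
      (measurable_cons_left hf (Fin.cons y r))
    have hhc : h (Fin.cons y r) = ∫⁻ x, f (Fin.cons x (Fin.cons y r))
        ∂select (m + 1) X (𝓜.backwardWeigh t (g, y)) := by
      rw [hh, integrateBackward, lintegral_backward, Fin.cons_zero]
    rw [← hhc] at hsel
    simp only [backwardWeigh, ENNReal.coe_mul] at hsel
    calc _ = pw y r * ((∑ j, ((g j).2 : ℝ≥0∞) * 𝓜.M (t + 1) (g j).1 y *
          𝓜.G (t + 1) (g j).1 y) * h (Fin.cons y r)) := by
          rw [Finset.sum_mul, Finset.mul_sum]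
          exact Finset.sum_congr rfl fun i _ => by ring
      _ = _ := by
          rw [hsel, Finset.mul_sum]
          exact Finset.sum_congr rfl fun i _ => by ring

end Model

namespace Model

variable {X : Type*} [MeasurableSpace X] {μ : Measure X}

/-! ### Invariance of the target -/

lemma lintegral_map_initLaw (𝓜 : Model X μ) {φ : X × ℝ≥0 → ℝ≥0∞} (hφ : Measurable φ) :
    ∫⁻ a, φ a ∂(𝓜.initLaw.map 𝓜.weigh₁) = ∫⁻ x, (𝓜.M₁ x : ℝ≥0∞) * φ (x, 𝓜.G₁ x) ∂μ := by
  rw [lintegral_map hφ 𝓜.measurable_weigh₁, initLaw]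
  exact lintegral_withDensity_eq_lintegral_mul _ 𝓜.measurable_M₁.coe_nnreal_ennreal
    (hφ.comp 𝓜.measurable_weigh₁)

variable [SigmaFinite μ]

/-- The density `gamma` factors as `M₁ G₁` times `pathWeight`: its first state is a draw from the
initial law biased by its weight. With the other particles i.i.d. from that law,
`lintegral_sizeBiased` applies and its hypothesis is `sum_lintegral_run`. -/
theorem lintegral_gamma_mul_cbpf (𝓜 : Model X μ) (m n : ℕ) {f : (Fin (n + 1) → X) → ℝ≥0∞}
    (hf : Measurable f) :
    ∫⁻ x, (𝓜.gamma (n + 1) x : ℝ≥0∞) * ∫⁻ z, f z ∂𝓜.cbpf (m + 1) (n + 1) x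
        ∂(Measure.pi fun _ => μ) =
      ∫⁻ x, (𝓜.gamma (n + 1) x : ℝ≥0∞) * f x ∂(Measure.pi fun _ => μ) := by
  set ν := 𝓜.initLaw.map 𝓜.weigh₁ with hν
  have : IsProbabilityMeasure ν := Measure.isProbabilityMeasure_map 𝓜.measurable_weigh₁.aemeasurable
  set pw := 𝓜.pathWeight n 1 with hpw
  have hpwm : Measurable (Function.uncurry pw) := 𝓜.measurable_pathWeight n 1
  have hpwr : ∀ x, Measurable (pw x) := fun x => hpwm.comp (measurable_const.prodMk measurable_id)
  set Φ : Generation (m + 1) X → (Fin n → X) → ℝ≥0∞ := fun g' r =>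
    ∫⁻ z, f z ∂𝓜.run (m + 1) n 1 (g', r) with hΦ
  have hΦm : Measurable (Function.uncurry Φ) := hf.lintegral_kernel
  have hB : Measurable fun a : X × ℝ≥0 => (a.2 : ℝ≥0∞) * ∫⁻ r, pw a.1 r *
      ∫⁻ g', Φ (Fin.cons a g') r
        ∂(Measure.pi fun _ : Fin m => ν) ∂(Measure.pi fun _ : Fin n => μ) := by
    refine measurable_snd.coe_nnreal_ennreal.mul (Measurable.lintegral_prod_right'
      (f := fun p : (X × ℝ≥0) × (Fin n → X) =>
        pw p.1.1 p.2 * ∫⁻ g', Φ (Fin.cons p.1 g') p.2 ∂(Measure.pi fun _ : Fin m => ν)) ?_)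
    refine Measurable.mul (hpwm.comp (by fun_prop :
      Measurable fun p : (X × ℝ≥0) × (Fin n → X) => (p.1.1, p.2))) ?_
    refine Measurable.lintegral_prod_right'
      (f := fun q : ((X × ℝ≥0) × (Fin n → X)) × (Fin m → X × ℝ≥0) =>
        Φ (Fin.cons q.1.1 q.2) q.1.2) ?_
    exact hΦm.comp ((measurable_cons.comp
      ((measurable_fst.comp measurable_fst).prodMk measurable_snd)).prodMk
      (measurable_snd.comp measurable_fst))
  have hpwf : Measurable fun p : X × (Fin n → X) => pw p.1 p.2 * f (Fin.cons p.1 p.2) :=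
    hpwm.mul (hf.comp measurable_cons)
  have hC : Measurable fun a : X × ℝ≥0 => (a.2 : ℝ≥0∞) * ∫⁻ r, pw a.1 r * f (Fin.cons a.1 r)
      ∂(Measure.pi fun _ : Fin n => μ) :=
    measurable_snd.coe_nnreal_ennreal.mul (hpwf.lintegral_prod_right'.comp measurable_fst)
  have hsize := lintegral_sizeBiased (μ := μ) ν hpwm hΦm hf
    fun g' => 𝓜.sum_lintegral_run n 1 g' hf
  rw [lintegral_map_initLaw 𝓜 hB, lintegral_map_initLaw 𝓜 hC] at hsize
  have hγP : Measurable fun x => (𝓜.gamma (n + 1) x : ℝ≥0∞) *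
      ∫⁻ z, f z ∂𝓜.cbpf (m + 1) (n + 1) x := (𝓜.measurable_gamma n).mul hf.lintegral_kernel
  have hγf : Measurable fun x => (𝓜.gamma (n + 1) x : ℝ≥0∞) * f x := (𝓜.measurable_gamma n).mul hf
  rw [lintegral_pi_cons _ hγP, lintegral_pi_cons _ hγf]
  refine Eq.trans (lintegral_congr fun x => ?_) (hsize.trans (lintegral_congr fun x => ?_))
  · have hinner : ∀ r : Fin n → X, ∫⁻ z, f z ∂𝓜.cbpf (m + 1) (n + 1) (Fin.cons x r) =
        ∫⁻ g', Φ (Fin.cons (x, 𝓜.G₁ x) g') r ∂(Measure.pi fun _ : Fin m => ν) := by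
      intro r
      have hΦr : Measurable fun g' => Φ g' r := hΦm.comp (measurable_id.prodMk measurable_const)
      rw [lintegral_cbpf_succ _ _ _ hf]
      exact 𝓜.lintegral_initGeneration x hΦr
    have hD : Measurable fun r : Fin n → X => pw x r *
        ∫⁻ g', Φ (Fin.cons (x, 𝓜.G₁ x) g') r ∂(Measure.pi fun _ : Fin m => ν) := by
      refine (hpwr x).mul (Measurable.lintegral_prod_right'
        (f := fun q : (Fin n → X) × (Fin m → X × ℝ≥0) =>
          Φ (Fin.cons (x, 𝓜.G₁ x) q.2) q.1) ?_)
      exact hΦm.comp ((measurable_cons.comp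
        (measurable_const.prodMk measurable_snd)).prodMk measurable_fst)
    rw [← mul_assoc, ← lintegral_const_mul _ hD]
    simp only [hinner, gamma_succ, mul_assoc, hpw]
  · have hD : Measurable fun r : Fin n → X => pw x r * f (Fin.cons x r) :=
      hpwf.comp (measurable_const.prodMk measurable_id)
    rw [← mul_assoc, ← lintegral_const_mul _ hD]
    simp only [gamma_succ, mul_assoc, hpw]

/-! ### Normalisation of the target and its invariance. -/

variable {𝓜 : Model X μ} {T : ℕ} {ε : ℝ≥0}

/-- The normalising constants of the future are bounded and bounded away from zero. -/
lemma exists_lintegral_pathWeight_bounds (h : 𝓜.StrongMixing T ε) (n t : ℕ) (ht : 1 ≤ t)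
    (htT : t + n ≤ T) : ∃ l u : ℝ≥0∞, l ≠ 0 ∧ u ≠ ∞ ∧ ∀ x,
      l ≤ ∫⁻ r, 𝓜.pathWeight n t x r ∂(Measure.pi fun _ : Fin n => μ) ∧
      ∫⁻ r, 𝓜.pathWeight n t x r ∂(Measure.pi fun _ : Fin n => μ) ≤ u := by
  induction n generalizing t with
  | zero => exact ⟨1, 1, by simp, by simp, fun x => by simp [pathWeight]⟩
  | succ n ih =>
    obtain ⟨l, u, hl, hu, hlu⟩ := ih (t + 1) (by omega) (by omega)
    refine ⟨𝓜.Glow (t + 1) * l, 𝓜.Gup (t + 1) * u, mul_ne_zero ?_ hl,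
      ENNReal.mul_ne_top ENNReal.coe_ne_top hu, fun x => ?_⟩
    · exact_mod_cast (h.Glow_pos (t + 1) (by omega) (by omega)).ne'
    have hpwr : ∀ y, Measurable (𝓜.pathWeight n (t + 1) y) := fun y =>
      (𝓜.measurable_pathWeight n (t + 1)).comp (measurable_const.prodMk measurable_id)
    have heq : ∫⁻ r, 𝓜.pathWeight (n + 1) t x r ∂(Measure.pi fun _ : Fin (n + 1) => μ) =
        ∫⁻ y, (𝓜.M (t + 1) x y : ℝ≥0∞) * (𝓜.G (t + 1) x y *
          ∫⁻ r, 𝓜.pathWeight n (t + 1) y r ∂(Measure.pi fun _ : Fin n => μ)) ∂μ := by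
      have hx : Measurable (𝓜.pathWeight (n + 1) t x) :=
        (𝓜.measurable_pathWeight (n + 1) t).comp (measurable_const.prodMk measurable_id)
      rw [lintegral_pi_cons _ hx]
      refine lintegral_congr fun y => ?_
      rw [← mul_assoc, ← lintegral_const_mul _ (hpwr y)]
      simp only [pathWeight, Fin.cons_zero, Fin.cons_succ]
    have hG := fun y => h.G_mem (t := t + 1) (by omega) (by omega) x y
    have hM : Measurable fun y => (𝓜.M (t + 1) x y : ℝ≥0∞) :=
      ((𝓜.measurable_M (t + 1)).comp (measurable_const.prodMk measurable_id)).coe_nnreal_ennreal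
    -- The transition densities integrate to one, so only the bounds on the potentials accumulate.
    have hconst : ∀ c : ℝ≥0∞, ∫⁻ y, (𝓜.M (t + 1) x y : ℝ≥0∞) * c ∂μ = c := fun c => by
      rw [lintegral_mul_const _ hM, 𝓜.lintegral_M, one_mul]
    rw [heq]
    constructor
    · refine (hconst _).symm.le.trans (lintegral_mono fun y => ?_)
      gcongr
      · exact (hG y).1
      · exact (hlu y).1
    · refine (lintegral_mono fun y => ?_).trans (hconst _).le
      gcongr
      · exact (hG y).2
      · exact (hlu y).2

lemma normConst_pos_finite (h : 𝓜.StrongMixing T ε) (hT : 1 ≤ T) :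
    𝓜.normConst T ≠ 0 ∧ 𝓜.normConst T ≠ ∞ := by
  obtain ⟨n, rfl⟩ : ∃ n, T = n + 1 := ⟨T - 1, by omega⟩
  obtain ⟨l, u, hl, hu, hlu⟩ := exists_lintegral_pathWeight_bounds h n 1 le_rfl (by omega)
  have heq : 𝓜.normConst (n + 1) = ∫⁻ x, (𝓜.M₁ x : ℝ≥0∞) * (𝓜.G₁ x *
      ∫⁻ r, 𝓜.pathWeight n 1 x r ∂(Measure.pi fun _ : Fin n => μ)) ∂μ := by
    rw [normConst, lintegral_pi_cons _ (𝓜.measurable_gamma n)]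
    refine lintegral_congr fun x => ?_
    have hx : Measurable (𝓜.pathWeight n 1 x) :=
      (𝓜.measurable_pathWeight n 1).comp (measurable_const.prodMk measurable_id)
    rw [← mul_assoc, ← lintegral_const_mul _ hx]
    simp only [gamma_succ]
  have hconst : ∀ c : ℝ≥0∞, ∫⁻ x, (𝓜.M₁ x : ℝ≥0∞) * c ∂μ = c := fun c => by
    rw [lintegral_mul_const _ 𝓜.measurable_M₁.coe_nnreal_ennreal, 𝓜.lintegral_M₁, one_mul]
  have hlow : (𝓜.Glow 1 : ℝ≥0∞) * l ≤ 𝓜.normConst (n + 1) := by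
    rw [heq]
    refine (hconst _).symm.le.trans (lintegral_mono fun x => ?_)
    gcongr
    · exact (h.G₁_mem x).1
    · exact (hlu x).1
  have hup : 𝓜.normConst (n + 1) ≤ (𝓜.Gup 1 : ℝ≥0∞) * u := by
    rw [heq]
    refine (lintegral_mono fun x => ?_).trans (hconst _).le
    gcongr
    · exact (h.G₁_mem x).2
    · exact (hlu x).2
  refine ⟨fun h0 => ?_, fun h0 => ?_⟩
  · rw [h0, nonpos_iff_eq_zero] at hlow
    refine mul_ne_zero ?_ hl hlow
    exact_mod_cast (h.Glow_pos 1 le_rfl hT).ne'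
  · rw [h0, top_le_iff] at hup
    exact ENNReal.mul_ne_top ENNReal.coe_ne_top hu hup

lemma lintegral_target (n : ℕ) {f : (Fin (n + 1) → X) → ℝ≥0∞} (hf : Measurable f) :
    ∫⁻ x, f x ∂𝓜.target (n + 1) = (𝓜.normConst (n + 1))⁻¹ *
      ∫⁻ x, (𝓜.gamma (n + 1) x : ℝ≥0∞) * f x ∂(Measure.pi fun _ => μ) := by
  have hγf : Measurable fun x => (𝓜.gamma (n + 1) x : ℝ≥0∞) * f x := (𝓜.measurable_gamma n).mul hf
  rw [target, lintegral_withDensity_eq_lintegral_mul _ ((𝓜.measurable_gamma n).div_const _) hf,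
    ← lintegral_const_mul _ hγf]
  refine lintegral_congr fun x => ?_
  simp only [Pi.mul_apply, div_eq_mul_inv]
  ring

lemma isProbabilityMeasure_target (h : 𝓜.StrongMixing T ε) (hT : 1 ≤ T) :
    IsProbabilityMeasure (𝓜.target T) := by
  obtain ⟨h0, h1⟩ := normConst_pos_finite h hT
  obtain ⟨n, rfl⟩ : ∃ n, T = n + 1 := ⟨T - 1, by omega⟩
  refine ⟨?_⟩
  rw [← lintegral_one, lintegral_target n measurable_const]
  simp only [mul_one]
  exact ENNReal.inv_mul_cancel h0 h1

/-- The target is invariant. -/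
theorem lintegral_target_cbpf (m : ℕ) (hT : 1 ≤ T) {f : (Fin T → X) → ℝ≥0∞} (hf : Measurable f) :
    ∫⁻ x, ∫⁻ z, f z ∂𝓜.cbpf (m + 1) T x ∂𝓜.target T = ∫⁻ x, f x ∂𝓜.target T := by
  obtain ⟨n, rfl⟩ : ∃ n, T = n + 1 := ⟨T - 1, by omega⟩
  rw [lintegral_target n hf.lintegral_kernel, lintegral_target n hf, lintegral_gamma_mul_cbpf _ _ _ hf]

lemma lintegral_target_cbpf_pow (m : ℕ) (hT : 1 ≤ T) (k : ℕ) {f : (Fin T → X) → ℝ≥0∞}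
    (hf : Measurable f) :
    ∫⁻ x, ∫⁻ z, f z ∂(𝓜.cbpf (m + 1) T ^ k) x ∂𝓜.target T = ∫⁻ x, f x ∂𝓜.target T := by
  induction k with
  | zero =>
    refine lintegral_congr fun x => ?_
    rw [pow_zero]
    exact (congrArg (fun ν => ∫⁻ z, f z ∂ν) (Kernel.id_apply x)).trans (lintegral_dirac' x hf)
  | succ k ih =>
    rw [← ih, ← lintegral_target_cbpf m hT (hf.lintegral_kernel (κ := 𝓜.cbpf (m + 1) T ^ k))]
    refine lintegral_congr fun x => ?_
    rw [pow_succ]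
    exact Kernel.lintegral_comp _ _ _ hf

/-! ### Iteration -/

/-- The conclusion of `cbpf_le` has the form of its hypothesis with `w` multiplied by the
contraction factor. It is applied to the function obtained from `f` by `k` iterations. -/
lemma cbpf_pow_le (h : 𝓜.StrongMixing T ε) (hε : 0 < ε) (hT : 1 ≤ T) {m : ℕ} {K a : ℝ≥0∞}
    (ha : a ≤ 1) (hK1 : 1 ≤ K)
    (hK : a + ((1 - ε : ℝ≥0) : ℝ≥0∞) * K ≤ K * a) (d : ℕ) {w : ℝ≥0∞}
    {f : (Fin T → X) → ℝ≥0∞} (hfm : Measurable f)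
    (hf : ∀ (i : Fin T) x y, (∀ j, j ≠ i → x j = y j) → f x ≤ f y + w * a ^ (i : ℕ)) (k : ℕ)
    (i : Fin T) (x y : Fin T → X) (hxy : ∀ j, j ≠ i → x j = y j) :
    ∫⁻ z, f z ∂(𝓜.cbpf (m + 1) T ^ k) x ≤ ∫⁻ z, f z ∂(𝓜.cbpf (m + 1) T ^ k) y +
      contractionFactor ε K a (m + 1) d ^ k * w * a ^ (i : ℕ) := by
  induction k generalizing i x y with
  | zero =>
    have hid : ∀ x, ∫⁻ z, f z ∂(𝓜.cbpf (m + 1) T ^ 0) x = f x := fun x => by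
      rw [pow_zero]
      exact (congrArg (fun ν => ∫⁻ z, f z ∂ν) (Kernel.id_apply x)).trans (lintegral_dirac' x hfm)
    rw [hid, hid, pow_zero, one_mul]
    exact hf i x y hxy
  | succ k ih =>
    have hsucc : ∀ x, ∫⁻ z, f z ∂(𝓜.cbpf (m + 1) T ^ (k + 1)) x =
        ∫⁻ b, ∫⁻ z, f z ∂(𝓜.cbpf (m + 1) T ^ k) b ∂𝓜.cbpf (m + 1) T x := fun x => by
      rw [pow_succ]
      exact Kernel.lintegral_comp _ _ _ hfm
    rw [hsucc, hsucc]
    refine (cbpf_le h hε hT ha hK1 hK d hfm.lintegral_kernel ih i hxy).trans (le_of_eq ?_)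
    rw [pow_succ]
    ring

end Model

/-! ### Total variation -/

/-- A test function with values in `[-1, 1]` is `2 φ - 1` with `φ` in `[0, 1]`, whence the factor
`2`; this passes from real integrals to the one-sided extended nonnegative bounds used elsewhere. -/
lemma tvDist_le {E : Type*} [MeasurableSpace E] (p q : Measure E) [IsProbabilityMeasure p]
    [IsProbabilityMeasure q] {D : ℝ≥0∞}
    (h : ∀ φ : E → ℝ≥0∞, Measurable φ → (∀ x, φ x ≤ 1) →
      ∫⁻ x, φ x ∂p ≤ ∫⁻ x, φ x ∂q + D ∧ ∫⁻ x, φ x ∂q ≤ ∫⁻ x, φ x ∂p + D) :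
    tvDist p q ≤ 2 * D := by
  rcases eq_or_ne D ∞ with rfl | hD
  · simp
  refine iSup_le fun ⟨f, hf, hf1⟩ => ?_
  set φ : E → ℝ≥0∞ := fun x => ENNReal.ofReal ((f x + 1) / 2) with hφ
  have hφm : Measurable φ := by
    rw [hφ]
    fun_prop
  have hφ1 : ∀ x, φ x ≤ 1 := fun x => by
    have := (abs_le.1 (hf1 x)).2
    rw [hφ, ← ENNReal.ofReal_one]
    exact ENNReal.ofReal_le_ofReal (by linarith)
  have key : ∀ (ν : Measure E) [IsProbabilityMeasure ν],
      ∫ x, f x ∂ν = 2 * (∫⁻ x, φ x ∂ν).toReal - 1 ∧ ∫⁻ x, φ x ∂ν ≠ ∞ := by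
    intro ν _
    have hint : Integrable f ν := Integrable.of_bound hf.aestronglyMeasurable 1
      (ae_of_all _ fun x => by simpa using hf1 x)
    have h0 : 0 ≤ᵐ[ν] fun x => (f x + 1) / 2 := ae_of_all _ fun x => by
      have := (abs_le.1 (hf1 x)).1
      change 0 ≤ (f x + 1) / 2
      linarith
    have h1 := integral_eq_lintegral_of_nonneg_ae h0
      ((hf.add_const 1).div_const 2).aestronglyMeasurable
    rw [← h1, integral_div, integral_add hint (integrable_const 1)]
    refine ⟨by simp; ring, ?_⟩
    have : ∫⁻ x, φ x ∂ν ≤ 1 := (lintegral_mono hφ1).trans (by simp)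
    exact (this.trans_lt ENNReal.one_lt_top).ne
  obtain ⟨hp, hp'⟩ := key p
  obtain ⟨hq, hq'⟩ := key q
  obtain ⟨h1, h2⟩ := h φ hφm hφ1
  have h1' := (ENNReal.toReal_le_toReal hp' (ENNReal.add_ne_top.2 ⟨hq', hD⟩)).2 h1
  have h2' := (ENNReal.toReal_le_toReal hq' (ENNReal.add_ne_top.2 ⟨hp', hD⟩)).2 h2
  rw [ENNReal.toReal_add hq' hD] at h1'
  rw [ENNReal.toReal_add hp' hD] at h2'
  change ENNReal.ofReal |(∫ x, f x ∂p) - ∫ x, f x ∂q| ≤ 2 * D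
  rw [hp, hq]
  refine ENNReal.ofReal_le_of_le_toReal ?_
  rw [ENNReal.toReal_mul, ENNReal.toReal_ofNat, abs_le]
  constructor <;> linarith

namespace Model

variable {X : Type*} [MeasurableSpace X] {μ : Measure X} [SigmaFinite μ] {𝓜 : Model X μ} {T : ℕ}
  {ε : ℝ≥0}

/-- The weight `a⁻¹ ^ T` makes every coordinate bound at least `1`, so any test function bounded by
`1` is admissible. The decay in the coordinate is then summed as a geometric series. -/
theorem tvDist_cbpf_pow_le (h : 𝓜.StrongMixing T ε) (hε : 0 < ε) (hT : 1 ≤ T) (m : ℕ)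
    {K a : ℝ≥0∞} (ha : a ≤ 1) (ha0 : a ≠ 0) (hK1 : 1 ≤ K)
    (hK : a + ((1 - ε : ℝ≥0) : ℝ≥0∞) * K ≤ K * a) (d k : ℕ) (x : Fin T → X) :
    tvDist ((𝓜.cbpf (m + 1) T ^ k) x) (𝓜.target T) ≤
      2 * (contractionFactor ε K a (m + 1) d ^ k * a⁻¹ ^ T * (1 - a)⁻¹) := by
  have := isMarkovKernel_cbpf h hT m
  have := isProbabilityMeasure_target h hT
  have hprob : ∀ k, IsProbabilityMeasure ((𝓜.cbpf (m + 1) T ^ k) x) := by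
    intro k
    induction k with
    | zero =>
      rw [pow_zero]
      exact (inferInstance : IsMarkovKernel (Kernel.id : Kernel (Fin T → X) _)).isProbabilityMeasure x
    | succ k ih =>
      refine ⟨?_⟩
      rw [pow_succ', ← lintegral_one]
      refine (Kernel.lintegral_comp _ _ _ measurable_const).trans ?_
      simp
  have := hprob k
  have hone : ∀ i : Fin T, 1 ≤ a⁻¹ ^ T * a ^ (i : ℕ) := fun i => by
    have hat : a ≠ ∞ := (ha.trans_lt ENNReal.one_lt_top).ne
    calc (1 : ℝ≥0∞) = (a⁻¹ * a) ^ (i : ℕ) := by rw [ENNReal.inv_mul_cancel ha0 hat, one_pow]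
      _ = a⁻¹ ^ (i : ℕ) * a ^ (i : ℕ) := mul_pow _ _ _
      _ ≤ a⁻¹ ^ T * a ^ (i : ℕ) := by
          gcongr
          · exact ENNReal.one_le_inv.2 ha
          · exact i.2.le
  refine tvDist_le _ _ fun φ hφ hφ1 => ?_
  set D := contractionFactor ε K a (m + 1) d ^ k * a⁻¹ ^ T * (1 - a)⁻¹ with hD
  have hosc : ∀ x y, ∫⁻ z, φ z ∂(𝓜.cbpf (m + 1) T ^ k) x ≤
      ∫⁻ z, φ z ∂(𝓜.cbpf (m + 1) T ^ k) y + D := fun x y => by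
    refine (le_add_sum_of_osc (cbpf_pow_le h hε hT ha hK1 hK d hφ (w := a⁻¹ ^ T)
      (fun i x y _ => (hφ1 x).trans ((hone i).trans le_add_self)) k) x y).trans ?_
    rw [← Finset.mul_sum, hD]
    gcongr
    exact sum_pow_le a T
  -- By invariance the target integral is an average over starting points of the iterated integrals,
  -- so a bound uniform in two starting points suffices.
  rw [← lintegral_target_cbpf_pow (𝓜 := 𝓜) m hT k hφ]
  constructor
  · have := lintegral_le_add_of_osc (𝓜.target T) (𝓜.target T)
      (φ := fun _ => ∫⁻ z, φ z ∂(𝓜.cbpf (m + 1) T ^ k) x) fun _ y => hosc x y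
    simpa using this
  · have := lintegral_le_add_of_osc (𝓜.target T) (𝓜.target T)
      (φ' := fun _ => ∫⁻ z, φ z ∂(𝓜.cbpf (m + 1) T ^ k) x) fun y _ => hosc y x
    simpa using this

/-! ### The choice of the number of particles -/

/-- At fixed depth every term of the recursion carries a factor `1 / N`; the constant may grow
exponentially with the depth. -/
lemma exists_lipConst_le {ε K a : ℝ≥0} (hε : 0 < ε) (d : ℕ) :
    ∃ C : ℝ≥0∞, C ≠ ∞ ∧ ∀ N : ℕ, lipConst ε K a N d ≤ (N : ℝ≥0∞)⁻¹ * C := by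
  have hε' : (ε : ℝ≥0∞)⁻¹ ≠ ∞ := by simpa using hε.ne'
  induction d with
  | zero => exact ⟨0, by simp, fun N => by simp [lipConst]⟩
  | succ d ih =>
    obtain ⟨C, hC, hN⟩ := ih
    refine ⟨(ε : ℝ≥0∞)⁻¹ * K + (1 + (ε : ℝ≥0∞)⁻¹) * a * C, ?_, fun N => ?_⟩
    · exact ENNReal.add_ne_top.2 ⟨ENNReal.mul_ne_top hε' ENNReal.coe_ne_top, ENNReal.mul_ne_top
        (ENNReal.mul_ne_top (ENNReal.add_ne_top.2 ⟨ENNReal.one_ne_top, hε'⟩) ENNReal.coe_ne_top) hC⟩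
    · rw [lipConst, ENNReal.mul_inv (Or.inr (ENNReal.natCast_ne_top _))
        (Or.inl ENNReal.coe_ne_top)]
      calc _ ≤ (ε : ℝ≥0∞)⁻¹ * (N : ℝ≥0∞)⁻¹ * K +
            (1 + (ε : ℝ≥0∞)⁻¹) * a * ((N : ℝ≥0∞)⁻¹ * C) := by
            gcongr
            exact hN N
        _ = _ := by ring

/-- The depth `d` is fixed first to make the truncation error small; only then is the number of
particles chosen, as the constant in the Lipschitz bound depends on `d`. -/
lemma exists_contractionFactor_le {ε K a : ℝ≥0} (hε : 0 < ε) (ha : a < 1) {η : ℝ≥0∞}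
    (hη : η ≠ 0) : ∃ d N₀ : ℕ, ∀ N, N₀ ≤ N → contractionFactor ε K a N d ≤ η := by
  have ha' : (a : ℝ≥0∞) < 1 := by exact_mod_cast ha
  have hη2 : 0 < η / 2 := ENNReal.half_pos hη
  have h1 : Tendsto (fun d : ℕ => 2 * ((a : ℝ≥0∞) ^ d * (K + (1 - (a : ℝ≥0∞))⁻¹))) atTop (𝓝 0) := by
    have hfin : (K : ℝ≥0∞) + (1 - (a : ℝ≥0∞))⁻¹ ≠ ∞ :=
      ENNReal.add_ne_top.2 ⟨ENNReal.coe_ne_top, ENNReal.inv_ne_top.2 (tsub_pos_of_lt ha').ne'⟩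
    have := ENNReal.Tendsto.const_mul (a := 2) (ENNReal.Tendsto.mul_const
      (ENNReal.tendsto_pow_atTop_nhds_zero_of_lt_one ha') (Or.inr hfin)) (Or.inr ENNReal.ofNat_ne_top)
    simpa using this
  obtain ⟨d, hd⟩ := ((tendsto_order.1 h1).2 _ hη2).exists
  obtain ⟨C, hC, hCN⟩ := exists_lipConst_le (K := K) (a := a) hε d
  have h2 : Tendsto (fun N : ℕ => (N : ℝ≥0∞)⁻¹ * C) atTop (𝓝 0) := by
    have := ENNReal.Tendsto.mul_const ENNReal.tendsto_inv_nat_nhds_zero (Or.inr hC)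
    simpa using this
  obtain ⟨N₀, hN₀⟩ := eventually_atTop.1 ((tendsto_order.1 h2).2 _ hη2)
  refine ⟨d, N₀, fun N hN => ?_⟩
  rw [contractionFactor, ← ENNReal.add_halves η]
  exact add_le_add ((hCN N).trans (hN₀ N hN).le) hd.le

lemma exists_rate {ε : ℝ≥0} (hε : 0 < ε) {α : ℝ≥0} (hα : 1 < α) :
    ∃ a K : ℝ≥0, 0 < a ∧ a < 1 ∧ a⁻¹ ≤ α ∧ 1 ≤ K ∧ a + (1 - ε) * K ≤ K * a := by
  have hs : 1 - ε < 1 := tsub_lt_self one_pos hε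
  set s := 1 - ε with hs'
  have hα0 : 0 < α := one_pos.trans hα
  -- The second entry lies strictly between `s = 1 - ε` and `1`; with `a > s`, the choice `K = a /
  -- (a - s)` gives equality in the last condition.
  set a := max α⁻¹ ((1 + s) / 2) with ha
  have hsa : s < a := lt_of_lt_of_le (by
    rw [lt_div_iff₀ two_pos, mul_two]
    exact add_lt_add_left hs s) (le_max_right _ _)
  have ha0 : 0 < a := lt_of_lt_of_le (inv_pos.2 hα0) (le_max_left _ _)
  refine ⟨a, a / (a - s), ha0, max_lt (inv_lt_one_of_one_lt₀ hα) ?_, ?_, ?_, ?_⟩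
  · rw [div_lt_one two_pos, ← one_add_one_eq_two]
    exact add_lt_add_right hs 1
  · exact inv_le_of_inv_le₀ hα0 (le_max_left _ _)
  · rw [one_le_div (tsub_pos_of_lt hsa)]
    exact tsub_le_self
  · have h1 : a / (a - s) * (a - s) = a := div_mul_cancel₀ _ (tsub_pos_of_lt hsa).ne'
    calc a + s * (a / (a - s)) = a / (a - s) * (a - s) + a / (a - s) * s := by
          rw [h1, mul_comm s]
      _ = a / (a - s) * (a - s + s) := (mul_add _ _ _).symm
      _ ≤ a / (a - s) * a := by rw [tsub_add_cancel_of_le hsa.le]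

end Model

/-! ### Explicit rates and the limit of long horizons. -/

/-- The quantitative bound on the distance to the target. -/
theorem exists_tvDist_cbpf_pow_le {ε : ℝ≥0} (hε : 0 < ε) {α β : ℝ} (hα : 1 < α) (hβ : 1 < β) :
    ∃ N₀ : ℕ, ∀ N : ℕ, N₀ ≤ N →
      ∀ (X : Type u) [MeasurableSpace X] (μ : Measure X) [SigmaFinite μ] (𝓜 : Model X μ) (T : ℕ),
        1 ≤ T → 𝓜.StrongMixing T ε → ∀ k : ℕ, 1 ≤ k →
        ⨆ x : Fin T → X, tvDist (((𝓜.cbpf N T) ^ k) x) (𝓜.target T) ≤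
          ENNReal.ofReal (α ^ T * (β ^ k)⁻¹) := by
  obtain ⟨a, K, ha0, ha1, haα, hK1, hK⟩ := Model.exists_rate hε (α := α.toNNReal)
    (by rwa [← Real.toNNReal_one, Real.toNNReal_lt_toNNReal_iff (by linarith)])
  have ha1' : (a : ℝ≥0∞) < 1 := by exact_mod_cast ha1
  have ha0' : (a : ℝ≥0∞) ≠ 0 := by exact_mod_cast ha0.ne'
  -- The prefactor `2 / (1 - a)` is absorbed by asking for the contraction factor `1 / (β b)`: since
  -- `k ≥ 1`, one factor `b⁻¹` cancels it and the others are at most one.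
  set b : ℝ≥0∞ := 2 * (1 - (a : ℝ≥0∞))⁻¹ with hb
  have hb1 : 1 ≤ b := by
    calc (1 : ℝ≥0∞) ≤ 2 * 1 := by norm_num
      _ ≤ b := by
        rw [hb]
        gcongr
        exact ENNReal.one_le_inv.2 tsub_le_self
  have hbt : b ≠ ∞ := ENNReal.mul_ne_top ENNReal.ofNat_ne_top
    (ENNReal.inv_ne_top.2 (tsub_pos_of_lt ha1').ne')
  set B := ENNReal.ofReal β with hB
  obtain ⟨d, N₀, hN₀⟩ := Model.exists_contractionFactor_le (K := K) hε ha1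
    (η := B⁻¹ * b⁻¹) (mul_ne_zero (ENNReal.inv_ne_zero.2 ENNReal.ofReal_ne_top)
      (ENNReal.inv_ne_zero.2 hbt))
  -- The increment guarantees at least one particle.
  refine ⟨N₀ + 1, fun N hN X _ μ _ 𝓜 T hT h k hk => iSup_le fun x => ?_⟩
  obtain ⟨m, rfl⟩ : ∃ m, N = m + 1 := ⟨N - 1, by omega⟩
  have hK' : (a : ℝ≥0∞) + ((1 - ε : ℝ≥0) : ℝ≥0∞) * K ≤ K * a := by exact_mod_cast hK
  refine (Model.tvDist_cbpf_pow_le h hε hT m ha1'.le ha0' (by exact_mod_cast hK1) hK' d k x).trans ?_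
  obtain ⟨l, rfl⟩ : ∃ l, k = l + 1 := ⟨k - 1, by omega⟩
  have hrhs : ENNReal.ofReal (α ^ T * (β ^ (l + 1))⁻¹) =
      ENNReal.ofReal α ^ T * B⁻¹ ^ (l + 1) := by
    rw [ENNReal.ofReal_mul (by positivity), ENNReal.ofReal_pow (by linarith),
      ENNReal.ofReal_inv_of_pos (by positivity), ENNReal.ofReal_pow (by linarith),
      ENNReal.inv_pow]
  have hbinv : b⁻¹ ≤ 1 := ENNReal.inv_le_one.2 hb1
  calc _ ≤ 2 * ((B⁻¹ * b⁻¹) ^ (l + 1) * (a : ℝ≥0∞)⁻¹ ^ T * (1 - (a : ℝ≥0∞))⁻¹) := by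
        gcongr
        exact hN₀ _ (by omega)
    _ = (B⁻¹ ^ (l + 1) * (a : ℝ≥0∞)⁻¹ ^ T) * (b⁻¹ ^ l * (b⁻¹ * b)) := by
        rw [hb]
        ring
    _ ≤ (B⁻¹ ^ (l + 1) * ENNReal.ofReal α ^ T) * (1 * 1) := by
        gcongr
        · rw [← ENNReal.coe_inv ha0.ne']
          exact ENNReal.coe_le_coe.2 haα
        · exact pow_le_one' hbinv l
        · exact ENNReal.inv_mul_le_one _
    _ = _ := by
        rw [hrhs]
        ring

/-- The bound `α ^ T * β ^ (-k)` vanishes along `k = ⌈ρ T⌉` when `ρ > log α / log β`. -/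
lemma tendsto_of_le_geometric {D : ℕ → ℕ → ℝ≥0∞} {α β ρ : ℝ} (hα : 1 < α) (hβ : 1 < β)
    (hρ : Real.log α / Real.log β < ρ)
    (hD : ∀ T, 1 ≤ T → ∀ k, 1 ≤ k → D T k ≤ ENNReal.ofReal (α ^ T * (β ^ k)⁻¹)) :
    Tendsto (fun T : ℕ => D T ⌈ρ * T⌉₊) atTop (𝓝 0) := by
  have hα0 : 0 < α := by linarith
  have hβ0 : 0 < β := by linarith
  have hρ0 : 0 < ρ := lt_of_le_of_lt
    (div_nonneg (Real.log_pos hα).le (Real.log_pos hβ).le) hρ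
  have hβρ : 0 < β ^ ρ := Real.rpow_pos_of_pos hβ0 ρ
  -- The bound along `k = ⌈ρ T⌉` is at most `(α / β ^ ρ) ^ T`, and the condition on `ρ` says exactly
  -- that this ratio is below one.
  have hq : α / β ^ ρ < 1 := by
    rw [div_lt_one hβρ, ← Real.log_lt_log_iff hα0 hβρ, Real.log_rpow hβ0]
    rwa [div_lt_iff₀ (Real.log_pos hβ)] at hρ
  have hlim : Tendsto (fun T : ℕ => ENNReal.ofReal ((α / β ^ ρ) ^ T)) atTop (𝓝 0) := by
    have := ENNReal.tendsto_ofReal (tendsto_pow_atTop_nhds_zero_of_lt_one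
      (div_nonneg hα0.le hβρ.le) hq)
    rwa [ENNReal.ofReal_zero] at this
  refine tendsto_of_tendsto_of_tendsto_of_le_of_le' tendsto_const_nhds hlim
    (Eventually.of_forall fun _ => zero_le) ?_
  filter_upwards [eventually_ge_atTop 1] with T hT
  have hT0 : (0 : ℝ) < T := by exact_mod_cast hT
  refine (hD T hT _ (Nat.one_le_iff_ne_zero.2 (Nat.ceil_pos.2 (mul_pos hρ0 hT0)).ne')).trans ?_
  refine ENNReal.ofReal_le_ofReal ?_
  rw [div_pow, div_eq_mul_inv, ← Real.rpow_natCast (β ^ ρ), ← Real.rpow_mul hβ0.le,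
    ← Real.rpow_natCast β]
  gcongr
  · exact hβ.le
  · exact Nat.le_ceil _

end ParticleFilter

theorem theorem1 (ε : ℝ≥0) (hε : 0 < ε) :
    (∀ ρ : ℝ, 0 < ρ → ∃ N₀ : ℕ, ∀ N : ℕ, N₀ ≤ N →
      ∀ (X : Type u) [MeasurableSpace X] (μ : Measure X) [SigmaFinite μ] (𝓜 : ℕ → Model X μ),
        (∀ T : ℕ, 1 ≤ T → (𝓜 T).StrongMixing T ε) →
        Tendsto (fun T : ℕ => ⨆ x : Fin T → X,
          tvDist ((((𝓜 T).cbpf N T) ^ ⌈ρ * T⌉₊) x) ((𝓜 T).target T)) atTop (𝓝 0)) ∧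
    (∀ α β : ℝ, 1 < α → 1 < β → ∃ N₀ : ℕ, ∀ N : ℕ, N₀ ≤ N →
      ∀ (X : Type u) [MeasurableSpace X] (μ : Measure X) [SigmaFinite μ],
        (∀ (𝓜 : Model X μ) (T : ℕ), 1 ≤ T → 𝓜.StrongMixing T ε → ∀ k : ℕ, 1 ≤ k →
          ⨆ x : Fin T → X, tvDist (((𝓜.cbpf N T) ^ k) x) (𝓜.target T) ≤
            ENNReal.ofReal (α ^ T * (β ^ k)⁻¹)) ∧
        (∀ 𝓜 : ℕ → Model X μ, (∀ T : ℕ, 1 ≤ T → (𝓜 T).StrongMixing T ε) →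
          ∀ ρ : ℝ, Real.log α / Real.log β < ρ →
            Tendsto (fun T : ℕ => ⨆ x : Fin T → X,
              tvDist ((((𝓜 T).cbpf N T) ^ ⌈ρ * T⌉₊) x) ((𝓜 T).target T)) atTop (𝓝 0))) := by
  refine ⟨fun ρ hρ => ?_, fun α β hα hβ => ?_⟩
  -- Part 1 uses `α = 2` and `β = 2 ^ (2 / ρ)`, for which `log α / log β = ρ / 2 < ρ`.
  · have hβ : 1 < Real.exp (2 * Real.log 2 / ρ) :=
      Real.one_lt_exp_iff.2 (div_pos (mul_pos two_pos (Real.log_pos one_lt_two)) hρ)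
    have hρ' : Real.log 2 / Real.log (Real.exp (2 * Real.log 2 / ρ)) < ρ := by
      have h2 := Real.log_pos one_lt_two
      rw [Real.log_exp, div_div_eq_mul_div, div_lt_iff₀ (by positivity)]
      nlinarith [mul_pos h2 hρ]
    obtain ⟨N₀, hN₀⟩ := exists_tvDist_cbpf_pow_le.{u} hε one_lt_two hβ
    exact ⟨N₀, fun N hN X _ μ _ 𝓜 h => tendsto_of_le_geometric one_lt_two hβ hρ'
      (D := fun T k => ⨆ x : Fin T → X, tvDist ((((𝓜 T).cbpf N T) ^ k) x) ((𝓜 T).target T))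
      fun T hT k hk => hN₀ N hN X μ (𝓜 T) T hT (h T hT) k hk⟩
  · obtain ⟨N₀, hN₀⟩ := exists_tvDist_cbpf_pow_le.{u} hε hα hβ
    exact ⟨N₀, fun N hN X _ μ _ => ⟨fun 𝓜 T hT h k hk => hN₀ N hN X μ 𝓜 T hT h k hk,
      fun 𝓜 h ρ hρ => tendsto_of_le_geometric hα hβ hρ
        (D := fun T k => ⨆ x : Fin T → X, tvDist ((((𝓜 T).cbpf N T) ^ k) x) ((𝓜 T).target T))
        fun T hT k hk => hN₀ N hN X μ (𝓜 T) T hT (h T hT) k hk⟩⟩
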